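/- Let $\xi$ be a random variable with values in $\{0,1,2,\dots\}$ such that $\mathbb E\,\xi=1$ and $0<\operatorname{Var}\xi<\infty$, and let $\mathcal T$ be the family tree of the Galton–Watson process with offspring distribution $\xi$, rooted at the progenitor. For $n\ge 1$ with $\mathbb P(|\mathcal T|=n)>0$, let $T_n$ be $\mathcal T$ conditioned on having exactly $n$ vertices, and let $T_n^*$ be the rooted tree obtained from $T_n$ by keeping all its vertices and edges and taking as new root a vertex chosen uniformly at random (given $T_n$) among the $n$ vertices. For a rooted tree $\tau$ let $Z_k(\tau)$ be the number of vertices of $\tau$ at graph distance $k$ from the root. Then there is a constant $C<\infty$, depending only on the distribution of $\xi$, such that $$\mathbb E\, Z_k(T_n^*)\le C\,k$$ for all integers $k\ge 1$ and all integers $n\ge1$ with $\mathbb P(|\mathcal T|=n)>0$. -/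

import Mathlib

open MeasureTheory ProbabilityTheory
open scoped ENNReal NNReal

namespace GaltonWatson

/-- Individuals of a branching process, named by Ulam–Harris words: `[]` is the progenitor and
`i :: u` is the `i`-th child (counted from `0`) of `u`. Given the array `x` of the numbers of
children, `Born x u` says that the individual `u` actually exists. -/
def Born (x : List ℕ → ℕ) : List ℕ → Prop
  | [] => True
  | i :: u => Born x u ∧ i < x u

/-- The vertex set of the family tree, possibly infinite. -/
def familyTree (x : List ℕ → ℕ) : Set (List ℕ) := {u | Born x u}

/-- A finite rooted tree: a finite set of Ulam–Harris words closed under taking parents, with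
an arbitrary distinguished vertex as root (so the root need not be `[]`). -/
@[ext]
structure FinRootedTree where
  verts : Finset (List ℕ)
  parent_mem : ∀ (i : ℕ) (u : List ℕ), i :: u ∈ verts → u ∈ verts
  root : {u // u ∈ verts}

/-- Countably many trees: every set of trees is measurable. -/
instance : MeasurableSpace FinRootedTree := ⊤

namespace FinRootedTree

instance (τ : FinRootedTree) : Nonempty {u // u ∈ τ.verts} := ⟨τ.root⟩

/-- The underlying graph of the tree: the edges join parents and children. -/
def graph (τ : FinRootedTree) : SimpleGraph {u // u ∈ τ.verts} :=
  SimpleGraph.fromRel fun u v => ∃ i : ℕ, (v : List ℕ) = i :: (u : List ℕ)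

/-- The same tree with all its vertices, with `v` as the new root. -/
def reroot (τ : FinRootedTree) (v : {u // u ∈ τ.verts}) : FinRootedTree where
  verts := τ.verts
  parent_mem := τ.parent_mem
  root := v

/-- `Z_k(τ)`: the number of vertices at graph distance `k` from the root. -/
noncomputable def Z (k : ℕ) (τ : FinRootedTree) : ℕ :=
  Nat.card {w : {u // u ∈ τ.verts} // τ.graph.dist τ.root w = k}

end FinRootedTree

open Classical in
/-- The family tree of `x`, rooted at the progenitor, as a finite rooted tree. (An infinite family
tree is sent to the one-vertex tree; this value is irrelevant, since it is only used conditionally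
on the family tree having `n` vertices.) -/
noncomputable def finiteFamilyTree (x : List ℕ → ℕ) : FinRootedTree :=
  if h : (familyTree x).Finite then
    { verts := h.toFinset
      parent_mem := fun i u hu => by
        rw [Set.Finite.mem_toFinset] at hu ⊢
        exact And.left (show Born x u ∧ i < x u from hu)
      root := ⟨[], by rw [Set.Finite.mem_toFinset]; trivial⟩ }
  else
    { verts := {[]}
      parent_mem := fun i u hu => by simp at hu
      root := ⟨[], by simp⟩ }

/-- The law of the array of numbers of children in the Galton–Watson process: they are independent
with the offspring distribution `ξ`. -/
noncomputable def offspringArray (ξ : Measure ℕ) [IsProbabilityMeasure ξ] :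
    Measure (List ℕ → ℕ) :=
  Measure.infinitePi fun _ : List ℕ => ξ

/-- The event that the family tree has exactly `n` vertices. -/
def sizeEvent (n : ℕ) : Set (List ℕ → ℕ) := {x | (familyTree x).encard = n}

/-- The law of the conditioned Galton–Watson tree `T_n`. -/
noncomputable def condTree (ξ : Measure ℕ) [IsProbabilityMeasure ξ] (n : ℕ) :
    Measure FinRootedTree :=
  ((offspringArray ξ)[|sizeEvent n]).map finiteFamilyTree

/-- The law of the tree `T_n^*` obtained from `T_n` by choosing, given `T_n`, a uniformly random
vertex as the new root. -/
noncomputable def rerootedTree (ξ : Measure ℕ) [IsProbabilityMeasure ξ] (n : ℕ) :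
    Measure FinRootedTree :=
  (condTree ξ n).bind fun τ =>
    ((PMF.uniformOfFintype {u // u ∈ τ.verts}).map τ.reroot).toMeasure

/-! The following facts show that the push-forward above is along a measurable map, so that
the two laws are genuine probability measures. -/

theorem measurableSet_born (u : List ℕ) : MeasurableSet {x | Born x u} := by
  induction u with
  | nil => simp [Born]
  | cons i u ih =>
    have h : MeasurableSet {x : List ℕ → ℕ | i < x u} :=
      measurableSet_lt measurable_const (measurable_pi_apply u)
    exact ih.inter h

theorem measurableSet_familyTree_eq (s : Set (List ℕ)) : MeasurableSet {x | familyTree x = s} := by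
  have : {x | familyTree x = s} = ⋂ u, {x | Born x u ↔ u ∈ s} := by
    ext x
    simp [Set.ext_iff, familyTree]
  rw [this]
  refine MeasurableSet.iInter fun u => ?_
  by_cases hu : u ∈ s
  · simpa [hu] using measurableSet_born u
  · simpa [hu, Set.compl_def] using (measurableSet_born u).compl

theorem measurableSet_sizeEvent (n : ℕ) : MeasurableSet (sizeEvent n) := by
  have : sizeEvent n = ⋃ s : {s : Finset (List ℕ) // s.card = n}, {x | familyTree x = s.1} := by
    ext x
    simp only [sizeEvent, Set.mem_ofPred_eq, Set.mem_iUnion]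
    constructor
    · intro h
      have hf : (familyTree x).Finite := Set.finite_of_encard_eq_coe h
      refine ⟨⟨hf.toFinset, ?_⟩, by simp⟩
      rw [hf.encard_eq_coe_toFinset_card] at h
      exact_mod_cast h
    · rintro ⟨s, hs⟩
      rw [hs, Set.encard_coe_eq_coe_finsetCard, s.2]
  rw [this]
  exact MeasurableSet.iUnion fun s => measurableSet_familyTree_eq _

theorem measurable_finiteFamilyTree : Measurable finiteFamilyTree := by
  classical
  intro A _
  have : finiteFamilyTree ⁻¹' A =
      (⋃ s : {s : Finset (List ℕ) // ∃ y, finiteFamilyTree y ∈ A ∧ familyTree y = s},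
        {x | familyTree x = s.1}) ∪
      ({x | finiteFamilyTree x ∈ A} ∩ (⋃ s : Finset (List ℕ), {x | familyTree x = s})ᶜ) := by
    ext x
    simp only [Set.mem_preimage, Set.mem_union, Set.mem_iUnion, Set.mem_inter_iff,
      Set.mem_ofPred_eq, Set.mem_compl_iff, not_exists]
    constructor
    · intro h
      by_cases hx : ∃ s : Finset (List ℕ), familyTree x = s
      · obtain ⟨s, hs⟩ := hx
        exact Or.inl ⟨⟨s, x, h, hs⟩, hs⟩
      · exact Or.inr ⟨h, by simpa using hx⟩
    · rintro (⟨⟨s, y, hy, hys⟩, hs⟩ | h)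
      · have : familyTree x = familyTree y := hs.trans hys.symm
        have h2 : finiteFamilyTree x = finiteFamilyTree y := by
          unfold finiteFamilyTree
          by_cases hf : (familyTree x).Finite
          · have hf' : (familyTree y).Finite := this ▸ hf
            rw [dif_pos hf, dif_pos hf']
            have aux : ∀ (s t : Finset (List ℕ)) (h₁ h₂ h₃ h₄), s = t →
                FinRootedTree.mk s h₁ ⟨[], h₃⟩ = FinRootedTree.mk t h₂ ⟨[], h₄⟩ := by
              rintro s t _ _ _ _ rfl
              rfl
            exact aux _ _ _ _ _ _ (by simp only [this])
          · have hf' : ¬ (familyTree y).Finite := this ▸ hf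
            rw [dif_neg hf, dif_neg hf']
        rwa [h2]
      · exact h.1
  rw [this]
  have hfin : MeasurableSet (⋃ s : Finset (List ℕ), {x | familyTree x = s}) :=
    MeasurableSet.iUnion fun s => measurableSet_familyTree_eq _
  refine (MeasurableSet.iUnion fun s => measurableSet_familyTree_eq _).union ?_
  have hconst : ∀ x ∈ (⋃ s : Finset (List ℕ), {x | familyTree x = s})ᶜ,
      ¬ (familyTree x).Finite := by
    intro x hx hf
    exact hx (Set.mem_iUnion.2 ⟨hf.toFinset, by simp⟩)
  rcases Set.eq_empty_or_nonempty
    ({x | finiteFamilyTree x ∈ A} ∩ (⋃ s : Finset (List ℕ), {x | familyTree x = s})ᶜ) with h | h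
  · rw [h]
    exact MeasurableSet.empty
  · obtain ⟨y, hyA, hy⟩ := h
    have : {x | finiteFamilyTree x ∈ A} ∩ (⋃ s : Finset (List ℕ), {x | familyTree x = s})ᶜ =
        (⋃ s : Finset (List ℕ), {x | familyTree x = s})ᶜ := by
      refine Set.inter_eq_right.2 fun x hx => ?_
      have : finiteFamilyTree x = finiteFamilyTree y := by
        unfold finiteFamilyTree
        rw [dif_neg (hconst x hx), dif_neg (hconst y hy)]
      simpa [this] using hyA
    rw [this]
    exact hfin.compl

theorem isProbabilityMeasure_condTree (ξ : Measure ℕ) [IsProbabilityMeasure ξ] (n : ℕ)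
    (hn : offspringArray ξ (sizeEvent n) ≠ 0) : IsProbabilityMeasure (condTree ξ n) := by
  have : IsProbabilityMeasure (offspringArray ξ) := by
    unfold offspringArray
    infer_instance
  have := cond_isProbabilityMeasure hn
  exact Measure.isProbabilityMeasure_map measurable_finiteFamilyTree.aemeasurable

theorem isProbabilityMeasure_rerootedTree (ξ : Measure ℕ) [IsProbabilityMeasure ξ] (n : ℕ)
    (hn : offspringArray ξ (sizeEvent n) ≠ 0) : IsProbabilityMeasure (rerootedTree ξ n) := by
  have := isProbabilityMeasure_condTree ξ n hn
  constructor
  rw [rerootedTree, Measure.bind_apply MeasurableSet.univ measurable_from_top.aemeasurable]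
  simp

end GaltonWatson

namespace GaltonWatson

open PowerSeries Finset

/-- The formal composition `a(Q)` of power series over `ℝ≥0∞`. -/
noncomputable def ev (Q a : ℝ≥0∞⟦X⟧) : ℝ≥0∞⟦X⟧ :=
  PowerSeries.mk fun n => ∑' r, coeff r a * coeff n (Q ^ r)

theorem coeff_ev (Q a : ℝ≥0∞⟦X⟧) (n : ℕ) :
    coeff n (ev Q a) = ∑' r, coeff r a * coeff n (Q ^ r) := by
  simp [ev]

theorem coeff_ev_mul (Q a b : ℝ≥0∞⟦X⟧) (n : ℕ) :
    coeff n (ev Q a * b) = ∑' r, coeff r a * coeff n (Q ^ r * b) := by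
  simp only [coeff_mul, coeff_ev, ← ENNReal.tsum_mul_right, Finset.mul_sum]
  rw [← Summable.tsum_finsetSum (fun _ _ => ENNReal.summable)]
  simp only [mul_assoc]

theorem coeff_mul_eq_tsum (a b : ℝ≥0∞⟦X⟧) (n : ℕ) :
    coeff n (a * b) = ∑' r, coeff r a * coeff n (X ^ r * b) := by
  rw [coeff_mul, Finset.Nat.sum_antidiagonal_eq_sum_range_succ_mk]
  rw [tsum_eq_sum (s := range (n + 1))]
  · refine Finset.sum_congr rfl fun r hr => ?_
    rw [coeff_X_pow_mul', if_pos (by simpa [Nat.lt_succ_iff] using hr)]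
  · intro r hr
    rw [coeff_X_pow_mul', if_neg (by simpa [Nat.lt_succ_iff] using hr), mul_zero]

theorem tsum_sum_antidiagonal (f : ℕ → ℕ → ℝ≥0∞) :
    ∑' m, ∑ x ∈ antidiagonal m, f x.1 x.2 = ∑' r, ∑' s, f r s := by
  rw [← ENNReal.tsum_prod, ← (Finset.HasAntidiagonal.sigmaAntidiagonalEquivProd (A := ℕ)).tsum_eq,
    ENNReal.tsum_sigma']
  refine tsum_congr fun m => ?_
  rw [← Finset.sum_finset_coe, tsum_fintype]
  rfl

theorem ev_mul (Q a b : ℝ≥0∞⟦X⟧) : ev Q (a * b) = ev Q a * ev Q b := by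
  ext n
  rw [coeff_ev_mul, coeff_ev]
  simp only [mul_comm (Q ^ _) (ev Q b), coeff_ev_mul, ← ENNReal.tsum_mul_left]
  rw [← tsum_sum_antidiagonal
    (fun r s => coeff r a * (coeff s b * coeff n (Q ^ s * Q ^ r)))]
  refine tsum_congr fun m => ?_
  rw [coeff_mul, Finset.sum_mul]
  refine Finset.sum_congr rfl fun x hx => ?_
  rw [← pow_add, add_comm x.2 x.1, mem_antidiagonal.1 hx, mul_assoc]

theorem ev_X_pow (Q : ℝ≥0∞⟦X⟧) (r : ℕ) : ev Q (X ^ r) = Q ^ r := by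
  ext n
  rw [coeff_ev, tsum_eq_single r]
  · simp
  · intro s hs
    simp [coeff_X_pow, hs]

theorem ev_X (Q : ℝ≥0∞⟦X⟧) : ev Q X = Q := by simpa using ev_X_pow Q 1

theorem ev_pow (Q a : ℝ≥0∞⟦X⟧) (k : ℕ) : ev Q (a ^ k) = ev Q a ^ k := by
  induction k with
  | zero => simpa using ev_X_pow Q 0
  | succ k ih => rw [pow_succ, ev_mul, ih, pow_succ]

/-- The diagonal series `∑ [x^N] Φ^N z^N`; when `Φ` generates an offspring law, the coefficients are
the return probabilities of the associated centred random walk. -/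
noncomputable def diag (Φ : ℝ≥0∞⟦X⟧) : ℝ≥0∞⟦X⟧ :=
  PowerSeries.mk fun N => coeff N (Φ ^ N)

theorem coeff_pow_mul_diag {Q Φ : ℝ≥0∞⟦X⟧} (hQ : Q = X * ev Q Φ) (M r : ℕ) :
    coeff M (Q ^ r * diag Φ) = coeff M (X ^ r * Φ ^ M) := by
  induction M generalizing r with
  | zero =>
    cases r with
    | zero => simp [diag]
    | succ r =>
      nth_rw 1 [pow_succ', hQ]
      rw [mul_assoc, mul_assoc, pow_succ', mul_assoc]
      simp
  | succ M ih =>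
    cases r with
    | zero => simp [diag]
    | succ r =>
      have h : Q ^ (r + 1) * diag Φ = X * (ev Q (Φ * X ^ r) * diag Φ) := by
        rw [ev_mul, ev_X_pow]
        nth_rw 1 [pow_succ', hQ]
        ring
      rw [h, coeff_succ_X_mul, coeff_ev_mul]
      simp only [ih]
      rw [← coeff_mul_eq_tsum, ← coeff_succ_X_mul]
      congr 1
      ring

/-- Lagrange inversion. -/
theorem coeff_ev_mul_diag {Q Φ : ℝ≥0∞⟦X⟧} (hQ : Q = X * ev Q Φ) (a : ℝ≥0∞⟦X⟧) (M : ℕ) :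
    coeff M (ev Q a * diag Φ) = coeff M (a * Φ ^ M) := by
  rw [coeff_ev_mul, coeff_mul_eq_tsum]
  simp only [coeff_pow_mul_diag hQ]

theorem diag_eq {Q Φ : ℝ≥0∞⟦X⟧} (hQ : Q = X * ev Q Φ) :
    diag Φ = 1 + X * (ev Q (d⁄dX ℝ≥0∞ Φ) * diag Φ) := by
  ext N
  cases N with
  | zero => simp [diag]
  | succ N =>
    rw [map_add, coeff_succ_X_mul, coeff_ev_mul_diag hQ]
    have h := coeff_derivative (Φ ^ (N + 1)) N
    rw [derivative_pow] at h
    have h2 : ((N + 1 : ℕ) : ℝ≥0∞⟦X⟧) * Φ ^ (N + 1 - 1) * d⁄dX ℝ≥0∞ Φ =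
        C ((N : ℝ≥0∞) + 1) * (d⁄dX ℝ≥0∞ Φ * Φ ^ N) := by
      simp
      ring
    rw [h2, coeff_C_mul, mul_comm (coeff (N + 1) _)] at h
    have h3 := (ENNReal.mul_right_inj (a := (N : ℝ≥0∞) + 1) (by simp) (by finiteness)).1 h
    rw [h3]
    simp [diag, coeff_one]

theorem eq_diag_mul {Q Φ Y V : ℝ≥0∞⟦X⟧} (hQ : Q = X * ev Q Φ)
    (hY : Y = X * (ev Q (d⁄dX ℝ≥0∞ Φ) * Y) + V) : Y = diag Φ * V := by
  set U := ev Q (d⁄dX ℝ≥0∞ Φ)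
  have hW : diag Φ * V = X * (U * (diag Φ * V)) + V := by
    nth_rw 1 [diag_eq hQ]
    ring
  set W := diag Φ * V
  ext n
  induction n using Nat.strong_induction_on with
  | _ n ih =>
    rw [hY, hW, map_add, map_add]
    congr 1
    cases n with
    | zero => simp
    | succ n =>
      rw [coeff_succ_X_mul, coeff_succ_X_mul, coeff_mul, coeff_mul]
      refine Finset.sum_congr rfl fun x hx => ?_
      rw [ih x.2 (by have := mem_antidiagonal.1 hx; omega)]

theorem coeff_X_mul_derivative (f : ℝ≥0∞⟦X⟧) (n : ℕ) :
    coeff n (X * d⁄dX ℝ≥0∞ f) = n * coeff n f := by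
  cases n with
  | zero => simp
  | succ n => rw [coeff_succ_X_mul, coeff_derivative]; push_cast; ring

theorem X_mul_derivative_ev (Q a : ℝ≥0∞⟦X⟧) :
    X * d⁄dX ℝ≥0∞ (ev Q a) = ev Q (d⁄dX ℝ≥0∞ a) * (X * d⁄dX ℝ≥0∞ Q) := by
  ext n
  rw [coeff_X_mul_derivative, coeff_ev, coeff_ev_mul, ← ENNReal.tsum_mul_left,
    tsum_eq_zero_add' ENNReal.summable]
  have h0 : (n : ℝ≥0∞) * (coeff 0 a * coeff n (Q ^ 0)) = 0 := by
    cases n <;> simp [coeff_one]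
  rw [h0, zero_add]
  refine tsum_congr fun r => ?_
  rw [coeff_derivative, mul_left_comm, ← coeff_X_mul_derivative, derivative_pow]
  have h2 : X * (((r + 1 : ℕ) : ℝ≥0∞⟦X⟧) * Q ^ (r + 1 - 1) * d⁄dX ℝ≥0∞ Q) =
      C ((r : ℝ≥0∞) + 1) * (Q ^ r * (X * d⁄dX ℝ≥0∞ Q)) := by
    simp
    ring
  rw [h2, coeff_C_mul, mul_assoc]

/-- The Otter–Dwass formula. -/
theorem mul_coeff_eq {Q Φ : ℝ≥0∞⟦X⟧} (hQ : Q = X * ev Q Φ) (n : ℕ) :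
    n * coeff n Q = coeff n (X * Φ ^ n) := by
  have h : X * d⁄dX ℝ≥0∞ Q = X * (ev Q (d⁄dX ℝ≥0∞ Φ) * (X * d⁄dX ℝ≥0∞ Q)) + Q := by
    rw [← X_mul_derivative_ev]
    nth_rw 1 [hQ]
    rw [Derivation.leibniz]
    simp only [smul_eq_mul, derivative_X, mul_one]
    nth_rw 4 [hQ]
    ring
  have h2 := eq_diag_mul hQ h
  rw [← coeff_X_mul_derivative, h2, mul_comm]
  nth_rw 1 [← ev_X Q]
  exact coeff_ev_mul_diag hQ X n

theorem coeff_mul_le (a b : ℝ≥0∞⟦X⟧) (c : ℝ≥0∞) (hb : ∀ j, coeff j b ≤ c) (n : ℕ) :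
    coeff n (a * b) ≤ (∑' r, coeff r a) * c := by
  rw [coeff_mul_eq_tsum, ← ENNReal.tsum_mul_right]
  refine ENNReal.tsum_le_tsum fun r => ?_
  gcongr
  rw [coeff_X_pow_mul']
  split_ifs
  · exact hb _
  · exact zero_le

theorem tsum_coeff_mul (a b : ℝ≥0∞⟦X⟧) :
    ∑' n, coeff n (a * b) = (∑' r, coeff r a) * ∑' s, coeff s b := by
  simp only [coeff_mul, ← ENNReal.tsum_mul_right, ← ENNReal.tsum_mul_left]
  rw [tsum_sum_antidiagonal fun r s => coeff r a * coeff s b, ENNReal.tsum_comm]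

theorem tsum_coeff_pow (a : ℝ≥0∞⟦X⟧) (k : ℕ) :
    ∑' n, coeff n (a ^ k) = (∑' r, coeff r a) ^ k := by
  induction k with
  | zero => simp [coeff_one]
  | succ k ih => rw [pow_succ, tsum_coeff_mul, ih, pow_succ]

/-- A word is empty or decomposes into its last letter and the rest. -/
def wordEquiv : Option (ℕ × List ℕ) ≃ List ℕ where
  toFun o := o.elim [] fun q => q.2 ++ [q.1]
  invFun u := if h : u = [] then none else some (u.getLast h, u.dropLast)
  left_inv o := by cases o <;> simp
  right_inv u := by
    by_cases h : u = []
    · simp [h]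
    · simp [h, List.dropLast_append_getLast]

theorem tsum_option {α : Type*} (f : Option α → ℝ≥0∞) :
    ∑' o, f o = f none + ∑' a, f (some a) := by
  classical
  rw [ENNReal.tsum_eq_add_tsum_ite (none : Option α), ← (Option.some_injective α).tsum_eq]
  · simp
  · intro o ho
    cases o with
    | none => simp at ho
    | some q => exact ⟨q, rfl⟩

theorem tsum_words (f : List ℕ → ℝ≥0∞) :
    ∑' u, f u = f [] + ∑' i, ∑' v, f (v ++ [i]) := by
  rw [← wordEquiv.tsum_eq, tsum_option, ENNReal.tsum_prod']
  rfl

/-- The array with `d` at the empty word and `y i` on the subtree of the `i`-th child. -/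
def glue (d : ℕ) (y : ℕ → List ℕ → ℕ) (u : List ℕ) : ℕ :=
  (wordEquiv.symm u).elim d fun q => y q.1 q.2

/-- The array of the subtree of the `i`-th child of the progenitor. -/
def sub (i : ℕ) (x : List ℕ → ℕ) (u : List ℕ) : ℕ := x (u ++ [i])

theorem glue_nil (d : ℕ) (y : ℕ → List ℕ → ℕ) : glue d y [] = d := by
  simp [glue, wordEquiv]

theorem sub_glue (i d : ℕ) (y : ℕ → List ℕ → ℕ) : sub i (glue d y) = y i := by
  ext u
  simp [sub, glue, wordEquiv]

theorem measurable_sub (i : ℕ) : Measurable (sub i) :=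
  measurable_pi_iff.2 fun u => measurable_pi_apply (u ++ [i])

theorem measurable_optionElim {ι : Type*} :
    Measurable fun (q : ℕ × (ι → ℕ)) (o : Option ι) => o.elim q.1 q.2 := by
  refine measurable_pi_iff.2 fun o => ?_
  cases o with
  | none => exact measurable_fst
  | some i => exact (measurable_pi_apply i).comp measurable_snd

theorem infinitePi_option {ι : Type*} (ξ : Measure ℕ) [IsProbabilityMeasure ξ] :
    (ξ.prod (Measure.infinitePi fun _ : ι => ξ)).map (fun q (o : Option ι) => o.elim q.1 q.2) =
      Measure.infinitePi fun _ : Option ι => ξ := by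
  classical
  refine Measure.eq_infinitePi _ fun s t ht => ?_
  rw [Measure.map_apply measurable_optionElim
    (.pi s.countable_toSet fun i _ => ht i)]
  have h : (fun (q : ℕ × (ι → ℕ)) (o : Option ι) => o.elim q.1 q.2) ⁻¹' Set.pi s t =
      {d | none ∈ s → d ∈ t none} ×ˢ Set.pi (eraseNone s) fun i => t (some i) := by
    ext q
    simp [Set.mem_pi, Option.forall]
  rw [h, Measure.prod_prod, Measure.infinitePi_pi _ fun i _ => ht _]
  by_cases hs : none ∈ s
  · have hs' : s = insertNone (eraseNone s) := by
      rw [insertNone_eraseNone, insert_eq_self.2 hs]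
    conv_rhs => rw [hs', prod_insertNone]
    simp [hs]
  · have hs' : s = (eraseNone s).map Function.Embedding.some := by
      rw [map_some_eraseNone, erase_eq_of_notMem hs]
    conv_rhs => rw [hs', prod_map]
    simp [hs]

instance (ξ : Measure ℕ) [IsProbabilityMeasure ξ] : IsProbabilityMeasure (offspringArray ξ) := by
  unfold offspringArray
  infer_instance

/-- The branching property. -/
theorem lintegral_offspringArray (ξ : Measure ℕ) [IsProbabilityMeasure ξ]
    {F : (List ℕ → ℕ) → ℝ≥0∞} (hF : Measurable F) :
    ∫⁻ x, F x ∂(offspringArray ξ) = ∑' d, ξ {d} *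
      ∫⁻ y, F (glue d y) ∂(Measure.infinitePi fun _ : ℕ => offspringArray ξ) := by
  have h1 : (Measure.infinitePi fun _ : Option (ℕ × List ℕ) => ξ).map
      (MeasurableEquiv.piCongrLeft (fun _ => ℕ) wordEquiv) = offspringArray ξ :=
    Measure.infinitePi_map_piCongrLeft (fun _ : List ℕ => ξ) wordEquiv
  have h2 : (Measure.infinitePi fun _ : ℕ => offspringArray ξ).map
      (MeasurableEquiv.curry ℕ (List ℕ) ℕ).symm = Measure.infinitePi fun _ => ξ :=
    Measure.infinitePi_map_curry_symm (fun (_ : ℕ) (_ : List ℕ) => ξ)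
  have hG : Measurable fun a => F (MeasurableEquiv.piCongrLeft (fun _ => ℕ) wordEquiv a) :=
    hF.comp (MeasurableEquiv.measurable _)
  have hG' : Measurable fun q : ℕ × (ℕ × List ℕ → ℕ) =>
      F (MeasurableEquiv.piCongrLeft (fun _ => ℕ) wordEquiv fun o => o.elim q.1 q.2) :=
    hG.comp measurable_optionElim
  conv_lhs => rw [← h1]
  rw [lintegral_map hF (by fun_prop), ← infinitePi_option,
    lintegral_map hG measurable_optionElim,
    lintegral_prod _ hG'.aemeasurable,
    lintegral_countable', ← h2]
  refine tsum_congr fun d => ?_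
  rw [mul_comm, lintegral_map _ (by fun_prop)]
  · congr 1
    refine lintegral_congr fun y => ?_
    congr 1
    ext u
    obtain ⟨o, rfl⟩ := wordEquiv.surjective u
    rw [MeasurableEquiv.coe_piCongrLeft, Equiv.piCongrLeft_apply_apply]
    simp only [glue, Equiv.symm_apply_apply]
    rfl
  · exact hG'.comp measurable_prodMk_left

/-- The coefficientwise expectation of a random power series. -/
noncomputable def gf (ξ : Measure ℕ) [IsProbabilityMeasure ξ] (H : (List ℕ → ℕ) → ℝ≥0∞⟦X⟧) :
    ℝ≥0∞⟦X⟧ :=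
  PowerSeries.mk fun n => ∫⁻ x, coeff n (H x) ∂(offspringArray ξ)

theorem lintegral_coeff_prod (ξ : Measure ℕ) [IsProbabilityMeasure ξ]
    {H : ℕ → (List ℕ → ℕ) → ℝ≥0∞⟦X⟧} (hH : ∀ i n, Measurable fun x => coeff n (H i x))
    (d m : ℕ) :
    ∫⁻ y, coeff m (∏ i ∈ range d, H i (y i))
      ∂(Measure.infinitePi fun _ : ℕ => offspringArray ξ) =
        coeff m (∏ i ∈ range d, gf ξ (H i)) := by
  classical
  simp only [PowerSeries.coeff_prod]
  rw [lintegral_finsetSum]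
  · refine Finset.sum_congr rfl fun l _ => ?_
    have hind := iIndepFun_infinitePi (P := fun _ : ℕ => offspringArray ξ)
      (X := fun i x => coeff (l i) (H i x)) fun i => hH i (l i)
    rw [lintegral_prod_eq_prod_lintegral_of_indepFun (range d) _ hind
      fun i => (hH i (l i)).comp (measurable_pi_apply i)]
    refine Finset.prod_congr rfl fun i _ => ?_
    rw [gf, coeff_mk]
    exact (measurePreserving_eval_infinitePi (fun _ : ℕ => offspringArray ξ) i).lintegral_comp
      (hH i (l i))
  · intro l _
    exact Finset.measurable_prod _ fun i _ => (hH i (l i)).comp (measurable_pi_apply i)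

/-- `z ^ a` for `a` finite, `0` for `a` infinite. -/
noncomputable def ofENat (a : ℕ∞) : ℝ≥0∞⟦X⟧ :=
  PowerSeries.mk fun n => if a = n then 1 else 0

theorem ofENat_natCast (a : ℕ) : ofENat a = X ^ a := by
  ext n
  simp [ofENat, coeff_X_pow, eq_comm]

theorem ofENat_top : ofENat ⊤ = 0 := by
  ext n
  simp [ofENat]

theorem ofENat_add (a b : ℕ∞) : ofENat (a + b) = ofENat a * ofENat b := by
  induction a using ENat.recTopCoe with
  | top => simp [ofENat_top]
  | coe a =>
    induction b using ENat.recTopCoe with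
    | top => simp [ofENat_top]
    | coe b => rw [← Nat.cast_add, ofENat_natCast, ofENat_natCast, ofENat_natCast, pow_add]

theorem ofENat_sum (s : Finset ℕ) (f : ℕ → ℕ∞) :
    ofENat (∑ i ∈ s, f i) = ∏ i ∈ s, ofENat (f i) := by
  classical
  induction s using Finset.induction_on with
  | empty => simpa using ofENat_natCast 0
  | insert i s hi ih => rw [sum_insert hi, prod_insert hi, ofENat_add, ih]

theorem born_append (x : List ℕ → ℕ) (v : List ℕ) (i : ℕ) :
    Born x (v ++ [i]) ↔ i < x [] ∧ Born (sub i x) v := by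
  induction v with
  | nil => simp [Born]
  | cons j v ih =>
    change Born x (v ++ [i]) ∧ j < x (v ++ [i]) ↔ i < x [] ∧ Born (sub i x) v ∧ j < sub i x v
    rw [ih, and_assoc]
    rfl

/-- The indicator of the existence of an individual. -/
noncomputable def bornInd (x : List ℕ → ℕ) (u : List ℕ) : ℝ≥0∞ := (familyTree x).indicator 1 u

theorem bornInd_nil (x : List ℕ → ℕ) : bornInd x [] = 1 := by
  have h : [] ∈ familyTree x := trivial
  simp [bornInd, h]

theorem bornInd_append (x : List ℕ → ℕ) (v : List ℕ) (i : ℕ) :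
    bornInd x (v ++ [i]) = if i < x [] then bornInd (sub i x) v else 0 := by
  classical
  simp only [bornInd, familyTree, Set.indicator_apply, Set.mem_ofPred_eq, born_append]
  split_ifs <;> simp_all

theorem measurable_bornInd (u : List ℕ) : Measurable fun x => bornInd x u := by
  have h : (fun x => bornInd x u) = {x | Born x u}.indicator 1 := by
    classical
    ext x
    simp [bornInd, familyTree, Set.indicator_apply]
  rw [h]
  exact measurable_one.indicator (measurableSet_born u)

theorem tsum_bornInd (x : List ℕ → ℕ) (f : List ℕ → ℝ≥0∞) :
    ∑' u, f u * bornInd x u =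
      f [] + ∑ i ∈ range (x []), ∑' v, f (v ++ [i]) * bornInd (sub i x) v := by
  rw [tsum_words, bornInd_nil, mul_one, tsum_eq_sum (s := range (x []))]
  · congr 1
    refine Finset.sum_congr rfl fun i hi => tsum_congr fun v => ?_
    rw [bornInd_append, if_pos (mem_range.1 hi)]
  · intro i hi
    simp [bornInd_append, mem_range.not.1 hi]

theorem encard_familyTree (x : List ℕ → ℕ) :
    (familyTree x).encard = 1 + ∑ i ∈ range (x []), (familyTree (sub i x)).encard := by
  have h (x : List ℕ → ℕ) : ((familyTree x).encard : ℝ≥0∞) = ∑' u, 1 * bornInd x u := by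
    rw [← ENNReal.tsum_set_one, tsum_subtype (familyTree x) fun _ => (1 : ℝ≥0∞)]
    simp [bornInd, Pi.one_def]
  rw [← ENat.toENNReal_inj, h, tsum_bornInd x fun _ => 1, ENat.toENNReal_add, ENat.toENNReal_one,
    ← ENat.toENNRealRingHom_apply, map_sum]
  simp [h]

/-- The power series `z ^ |T|`. -/
noncomputable def sizePow (x : List ℕ → ℕ) : ℝ≥0∞⟦X⟧ := ofENat (familyTree x).encard

theorem coeff_sizePow (n : ℕ) (x : List ℕ → ℕ) :
    coeff n (sizePow x) = (sizeEvent n).indicator 1 x := by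
  classical
  simp [sizePow, ofENat, Set.indicator_apply, sizeEvent]

theorem sizePow_eq (x : List ℕ → ℕ) :
    sizePow x = X * ∏ i ∈ range (x []), sizePow (sub i x) := by
  rw [sizePow, encard_familyTree, ofENat_add, ofENat_sum]
  congr 1
  simpa using ofENat_natCast 1

theorem measurable_coeff_sizePow (n : ℕ) : Measurable fun x => coeff n (sizePow x) := by
  simp only [coeff_sizePow]
  exact measurable_one.indicator (measurableSet_sizeEvent n)

/-- The number of individuals in generation `k`. -/
noncomputable def genCount (k : ℕ) (x : List ℕ → ℕ) : ℝ≥0∞ :=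
  ∑' u : List ℕ, (if u.length = k then 1 else 0) * bornInd x u

theorem measurable_genCount (k : ℕ) : Measurable (genCount k) :=
  Measurable.tsum fun u => (measurable_bornInd u).const_mul _

theorem genCount_zero (x : List ℕ → ℕ) : genCount 0 x = 1 := by
  rw [genCount, tsum_bornInd]
  simp

theorem genCount_succ (k : ℕ) (x : List ℕ → ℕ) :
    genCount (k + 1) x = ∑ i ∈ range (x []), genCount k (sub i x) := by
  rw [genCount, tsum_bornInd]
  simp [genCount]

/-- The distance in the Ulam–Harris tree of the reversals of two words. -/
def revDist : List ℕ → List ℕ → ℕ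
  | [], w => w.length
  | v, [] => v.length
  | a :: v, b :: w => if a = b then revDist v w else v.length + w.length + 2

/-- The distance of two words in the Ulam–Harris tree. -/
def wordDist (v w : List ℕ) : ℕ := revDist v.reverse w.reverse

theorem wordDist_nil_left (w : List ℕ) : wordDist [] w = w.length := by
  simp [wordDist, revDist]

theorem wordDist_nil_right (v : List ℕ) : wordDist v [] = v.length := by
  unfold wordDist
  rw [← List.length_reverse]
  cases v.reverse <;> simp [revDist]

theorem wordDist_append (v w : List ℕ) (i j : ℕ) :
    wordDist (v ++ [i]) (w ++ [j]) =
      if i = j then wordDist v w else v.length + w.length + 2 := by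
  simp [wordDist, revDist]

/-- The number of ordered pairs of individuals at distance `k`. -/
noncomputable def pairCount (k : ℕ) (x : List ℕ → ℕ) : ℝ≥0∞ :=
  ∑' v, (∑' w, (if wordDist v w = k then 1 else 0) * bornInd x w) * bornInd x v

theorem measurable_pairCount (k : ℕ) : Measurable (pairCount k) :=
  Measurable.tsum fun v => (Measurable.tsum fun w =>
    (measurable_bornInd w).const_mul _).mul (measurable_bornInd v)

/-- The heights, above its children, at which a path of length `k` may end on the two sides of
its top vertex. -/
def splits (k : ℕ) : Finset (ℕ × ℕ) := (range k ×ˢ range k).filter fun q => q.1 + q.2 + 2 = k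

theorem card_splits_le (k : ℕ) : (splits k).card ≤ k := by
  have h : Set.InjOn Prod.fst (splits k : Set (ℕ × ℕ)) := by
    rintro ⟨a, b⟩ h1 ⟨c, d⟩ h2 (h : a = c)
    simp only [splits, coe_filter, Set.mem_ofPred_eq] at h1 h2
    ext <;> simp <;> omega
  calc (splits k).card = ((splits k).image Prod.fst).card := (card_image_of_injOn h).symm
    _ ≤ (range k).card := card_le_card fun a ha => by
      obtain ⟨q, hq, rfl⟩ := mem_image.1 ha
      simp only [splits, mem_filter, mem_product] at hq
      exact hq.1.1
    _ = k := card_range k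

theorem sum_splits (k a b : ℕ) :
    (if a + b + 2 = k then 1 else 0 : ℝ≥0∞) =
      ∑ q ∈ splits k, (if a = q.1 then 1 else 0) * (if b = q.2 then 1 else 0) := by
  classical
  have : ∀ q ∈ splits k, (if a = q.1 then 1 else 0 : ℝ≥0∞) * (if b = q.2 then 1 else 0) =
      if (a, b) = q then 1 else 0 := by
    rintro ⟨c, d⟩ _
    by_cases h1 : a = c <;> by_cases h2 : b = d <;> simp [h1, h2]
  rw [Finset.sum_congr rfl this, sum_ite_eq]
  refine if_congr ?_ rfl rfl
  simp only [splits, mem_filter, mem_product, mem_range]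
  omega

theorem pairCount_eq {k : ℕ} (hk : 1 ≤ k) (x : List ℕ → ℕ) :
    pairCount k x = 2 * genCount k x + ∑ i ∈ range (x []), pairCount k (sub i x) +
      ∑ i ∈ range (x []), ∑ j ∈ (range (x [])).erase i, ∑ q ∈ splits k,
        genCount q.1 (sub i x) * genCount q.2 (sub j x) := by
  have h0 : genCount k x = ∑ i ∈ range (x []), ∑' v : List ℕ,
      (if v.length + 1 = k then 1 else 0) * bornInd (sub i x) v := by
    obtain ⟨k, rfl⟩ := Nat.exists_eq_add_of_le' hk
    simp only [genCount_succ, add_left_inj]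
    rfl
  have h1 : pairCount k x = genCount k x + ∑ i ∈ range (x []), ∑' v : List ℕ,
      (∑' w, (if wordDist (v ++ [i]) w = k then 1 else 0) * bornInd x w) *
        bornInd (sub i x) v := by
    rw [pairCount, tsum_bornInd]
    simp [wordDist_nil_left, genCount]
  have h2 (i : ℕ) (v : List ℕ) :
      ∑' w, (if wordDist (v ++ [i]) w = k then 1 else 0) * bornInd x w =
        (if v.length + 1 = k then 1 else 0) + ∑ j ∈ range (x []), ∑' w,
          (if wordDist (v ++ [i]) (w ++ [j]) = k then 1 else 0) * bornInd (sub j x) w := by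
    rw [tsum_bornInd]
    simp [wordDist_nil_right]
  have h3 (i j : ℕ) (hij : j ≠ i) : ∑' v : List ℕ, (∑' w : List ℕ,
      (if wordDist (v ++ [i]) (w ++ [j]) = k then 1 else 0) * bornInd (sub j x) w) *
        bornInd (sub i x) v =
      ∑ q ∈ splits k, genCount q.1 (sub i x) * genCount q.2 (sub j x) := by
    simp only [wordDist_append, if_neg hij.symm, sum_splits, genCount, ← ENNReal.tsum_mul_left,
      ← ENNReal.tsum_mul_right, Finset.sum_mul]
    simp only [fun q : ℕ × ℕ => ENNReal.tsum_comm (f := fun w v : List ℕ => (if v.length = q.1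
      then 1 else 0) * bornInd (sub i x) v * ((if w.length = q.2 then 1 else 0) *
        bornInd (sub j x) w))]
    simp only [← Summable.tsum_finsetSum (fun _ _ => ENNReal.summable)]
    refine tsum_congr fun v => tsum_congr fun w => Finset.sum_congr rfl fun q _ => ?_
    ring
  have h4 (i : ℕ) (hi : i ∈ range (x [])) : ∑' v : List ℕ,
      (∑' w, (if wordDist (v ++ [i]) w = k then 1 else 0) * bornInd x w) *
        bornInd (sub i x) v =
      ∑' v : List ℕ, (if v.length + 1 = k then 1 else 0) * bornInd (sub i x) v +
        (pairCount k (sub i x) + ∑ j ∈ (range (x [])).erase i, ∑ q ∈ splits k,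
        genCount q.1 (sub i x) * genCount q.2 (sub j x)) := by
    simp only [h2, add_mul, Finset.sum_mul]
    rw [ENNReal.tsum_add, Summable.tsum_finsetSum (fun _ _ => ENNReal.summable),
      ← add_sum_erase _ _ hi]
    congr 2
    · simp [wordDist_append, pairCount]
    · exact Finset.sum_congr rfl fun j hj => h3 i j (ne_of_mem_erase hj)
  rw [h1, Finset.sum_congr rfl h4, sum_add_distrib, sum_add_distrib, ← h0, two_mul]
  ring

theorem prod_ite_eq_mul_pow {M : Type*} [CommMonoid M] {s : Finset ℕ} {i : ℕ} (hi : i ∈ s)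
    (h q : M) : ∏ l ∈ s, (if l = i then h else q) = h * q ^ (s.card - 1) := by
  rw [← mul_prod_erase s _ hi, if_pos rfl,
    Finset.prod_congr rfl fun l hl => if_neg (ne_of_mem_erase hl), prod_const, card_erase_of_mem hi]

theorem prod_ite_ite_eq_mul_pow {M : Type*} [CommMonoid M] {s : Finset ℕ} {i j : ℕ} (hi : i ∈ s)
    (hj : j ∈ s.erase i) (g h q : M) :
    ∏ l ∈ s, (if l = i then g else if l = j then h else q) = g * (h * q ^ (s.card - 2)) := by
  rw [← mul_prod_erase s _ hi, if_pos rfl,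
    Finset.prod_congr rfl fun l hl => if_neg (ne_of_mem_erase hl), prod_ite_eq_mul_pow hj,
    card_erase_of_mem hi, Nat.sub_sub]

/-- The generating function of the offspring distribution. -/
noncomputable def offspringSeries (ξ : Measure ℕ) : ℝ≥0∞⟦X⟧ := PowerSeries.mk fun d => ξ {d}

/-- The generating function of the total progeny. -/
noncomputable def sizeSeries (ξ : Measure ℕ) [IsProbabilityMeasure ξ] : ℝ≥0∞⟦X⟧ := gf ξ sizePow

section

variable (ξ : Measure ℕ) [IsProbabilityMeasure ξ]

theorem coeff_sizeSeries (n : ℕ) :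
    coeff n (sizeSeries ξ) = offspringArray ξ (sizeEvent n) := by
  simp only [sizeSeries, gf, coeff_mk, coeff_sizePow]
  exact lintegral_indicator_one (measurableSet_sizeEvent n)

theorem gf_eq_X_mul {H : (List ℕ → ℕ) → ℝ≥0∞⟦X⟧}
    (hH : ∀ n, Measurable fun x => coeff n (H x)) {ι : ℕ → Type} (s : ∀ d, Finset (ι d))
    (K : ∀ d, ι d → ℕ → (List ℕ → ℕ) → ℝ≥0∞⟦X⟧)
    (hK : ∀ d, ∀ q ∈ s d, ∀ i n, Measurable fun x => coeff n (K d q i x))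
    (h : ∀ x, H x = X * ∑ q ∈ s (x []), ∏ i ∈ range (x []), K (x []) q i (sub i x)) :
    gf ξ H = X * PowerSeries.mk fun n => ∑' d, ξ {d} *
      coeff n (∑ q ∈ s d, ∏ i ∈ range d, gf ξ (K d q i)) := by
  have h' (x : List ℕ → ℕ) (d : ℕ) (hd : x [] = d) :
      H x = X * ∑ q ∈ s d, ∏ i ∈ range d, K d q i (sub i x) := hd ▸ h x
  ext n
  cases n with
  | zero => simp [gf, h]
  | succ n =>
    rw [coeff_succ_X_mul, coeff_mk, gf, coeff_mk, lintegral_offspringArray ξ (hH _)]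
    refine tsum_congr fun d => ?_
    simp only [h' _ d (glue_nil d _), sub_glue, coeff_succ_X_mul, map_sum]
    rw [lintegral_finsetSum' _ fun q hq => ?_]
    · congr 1
      exact Finset.sum_congr rfl fun q hq => lintegral_coeff_prod ξ (hK d q hq) d n
    · simp only [PowerSeries.coeff_prod]
      exact (Finset.measurable_sum _ fun l _ => Finset.measurable_prod _ fun i _ =>
        (hK d q hq i _).comp (measurable_pi_apply i)).aemeasurable

theorem sizeSeries_eq : sizeSeries ξ = X * ev (sizeSeries ξ) (offspringSeries ξ) := by
  have h : sizeSeries ξ = _ := gf_eq_X_mul ξ measurable_coeff_sizePow (fun _ => (univ : Finset Unit))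
    (fun _ _ _ => sizePow) (fun _ _ _ _ n => measurable_coeff_sizePow n)
    (fun x => by simpa using sizePow_eq x)
  conv_lhs => rw [h]
  congr 1
  ext n
  simp [coeff_ev, offspringSeries]
  rfl

/-- The generating function of the expectation of `f` on the trees of given size. -/
noncomputable def weightedSeries (f : (List ℕ → ℕ) → ℝ≥0∞) : ℝ≥0∞⟦X⟧ :=
  gf ξ fun x => C (f x) * sizePow x

variable {ξ} {f g : (List ℕ → ℕ) → ℝ≥0∞}

theorem coeff_weightedSeries (f : (List ℕ → ℕ) → ℝ≥0∞) (n : ℕ) :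
    coeff n (weightedSeries ξ f) = ∫⁻ x in sizeEvent n, f x ∂(offspringArray ξ) := by
  rw [weightedSeries, gf, coeff_mk, ← lintegral_indicator (measurableSet_sizeEvent n)]
  refine lintegral_congr fun x => ?_
  by_cases hx : x ∈ sizeEvent n <;> simp [coeff_sizePow, hx]

theorem measurable_coeff_weighted (hf : Measurable f) (n : ℕ) :
    Measurable fun x => coeff n (C (f x) * sizePow x) := by
  simp only [coeff_C_mul]
  exact hf.mul (measurable_coeff_sizePow n)

theorem weightedSeries_one : weightedSeries ξ (fun _ => 1) = sizeSeries ξ := by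
  simp [weightedSeries, sizeSeries]

theorem weightedSeries_add (hf : Measurable f) :
    weightedSeries ξ (fun x => f x + g x) = weightedSeries ξ f + weightedSeries ξ g := by
  ext n
  simp only [map_add, coeff_weightedSeries]
  exact lintegral_add_left hf _

theorem weightedSeries_const_mul (c : ℝ≥0∞) (hf : Measurable f) :
    weightedSeries ξ (fun x => c * f x) = C c * weightedSeries ξ f := by
  ext n
  simp only [coeff_C_mul, coeff_weightedSeries]
  exact lintegral_const_mul c hf

theorem weightedSeries_finset_sum {ι : Type*} (s : Finset ι) {f : ι → (List ℕ → ℕ) → ℝ≥0∞}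
    (hf : ∀ i, Measurable (f i)) :
    weightedSeries ξ (fun x => ∑ i ∈ s, f i x) = ∑ i ∈ s, weightedSeries ξ (f i) := by
  ext n
  simp only [map_sum, coeff_weightedSeries]
  exact lintegral_finsetSum _ fun i _ => hf i

theorem measurable_sum_sub (hf : Measurable f) :
    Measurable fun x : List ℕ → ℕ => ∑ i ∈ range (x []), f (sub i x) := by
  have h := measurable_from_prod_countable_left (f := fun q : (List ℕ → ℕ) × ℕ =>
    ∑ i ∈ range q.2, f (sub i q.1))
    fun d => Finset.measurable_sum (range d) fun i _ => hf.comp (measurable_sub i)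
  exact h.comp (measurable_id.prodMk (measurable_pi_apply []))

theorem measurable_sum_sum_sub (hf : Measurable f) (hg : Measurable g) :
    Measurable fun x : List ℕ → ℕ => ∑ i ∈ range (x []), ∑ j ∈ (range (x [])).erase i,
      f (sub i x) * g (sub j x) := by
  have h := measurable_from_prod_countable_left (f := fun q : (List ℕ → ℕ) × ℕ =>
    ∑ i ∈ range q.2, ∑ j ∈ (range q.2).erase i, f (sub i q.1) * g (sub j q.1))
    fun d => Finset.measurable_sum (range d) fun i _ =>
      Finset.measurable_sum ((range d).erase i) fun j _ =>
      (hf.comp (measurable_sub i)).mul (hg.comp (measurable_sub j))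
  exact h.comp (measurable_id.prodMk (measurable_pi_apply []))

theorem weightedSeries_sum_sub (hf : Measurable f) :
    weightedSeries ξ (fun x => ∑ i ∈ range (x []), f (sub i x)) =
      X * (ev (sizeSeries ξ) (d⁄dX ℝ≥0∞ (offspringSeries ξ)) * weightedSeries ξ f) := by
  have h := gf_eq_X_mul ξ (measurable_coeff_weighted (measurable_sum_sub hf)) (fun d => range d)
    (fun _ i j x => if j = i then C (f x) * sizePow x else sizePow x)
    (fun d i _ j n => by
      split_ifs
      exacts [measurable_coeff_weighted hf n, measurable_coeff_sizePow n])
    (fun x => by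
      rw [sizePow_eq, map_sum, mul_left_comm, Finset.sum_mul]
      congr 1
      refine Finset.sum_congr rfl fun i hi => ?_
      have (j : ℕ) : (if j = i then C (f (sub j x)) * sizePow (sub j x) else sizePow (sub j x)) =
          (if j = i then C (f (sub i x)) else 1) * sizePow (sub j x) := by
        split_ifs with hj
        · rw [hj]
        · rw [one_mul]
      simp only [this, prod_mul_distrib]
      rw [prod_ite_eq_mul_pow hi, one_pow, mul_one])
  rw [weightedSeries, h]
  congr 1
  ext n
  rw [coeff_mk, coeff_ev_mul, tsum_eq_zero_add' ENNReal.summable]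
  simp only [range_zero, sum_empty, map_zero, mul_zero, zero_add]
  refine tsum_congr fun d => ?_
  have (i : ℕ) (hi : i ∈ range (d + 1)) : ∏ j ∈ range (d + 1),
      gf ξ (fun x => if j = i then C (f x) * sizePow x else sizePow x) =
        weightedSeries ξ f * sizeSeries ξ ^ d := by
    have h2 (j : ℕ) : gf ξ (fun x => if j = i then C (f x) * sizePow x else sizePow x) =
        if j = i then weightedSeries ξ f else sizeSeries ξ := by
      split_ifs <;> rfl
    simp only [h2]
    rw [prod_ite_eq_mul_pow hi, card_range, Nat.add_sub_cancel]
  rw [Finset.sum_congr rfl this, sum_const, card_range, coeff_derivative, map_nsmul,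
    nsmul_eq_mul, mul_comm (weightedSeries ξ f)]
  simp only [offspringSeries, coeff_mk]
  push_cast
  ring

theorem weightedSeries_sum_sum_sub (hf : Measurable f) (hg : Measurable g) :
    weightedSeries ξ (fun x => ∑ i ∈ range (x []), ∑ j ∈ (range (x [])).erase i,
      f (sub i x) * g (sub j x)) =
      X * (ev (sizeSeries ξ) (d⁄dX ℝ≥0∞ (d⁄dX ℝ≥0∞ (offspringSeries ξ))) *
        (weightedSeries ξ f * weightedSeries ξ g)) := by
  have h := gf_eq_X_mul ξ (measurable_coeff_weighted (measurable_sum_sum_sub hf hg))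
    (fun d => (range d).sigma fun i => (range d).erase i)
    (fun _ q l x => if l = q.1 then C (f x) * sizePow x else
      if l = q.2 then C (g x) * sizePow x else sizePow x)
    (fun d i _ j n => by
      split_ifs
      exacts [measurable_coeff_weighted hf n, measurable_coeff_weighted hg n,
        measurable_coeff_sizePow n])
    (fun x => by
      rw [sum_sigma, sizePow_eq, map_sum, mul_left_comm, Finset.sum_mul]
      congr 1
      refine Finset.sum_congr rfl fun i hi => ?_
      rw [map_sum, Finset.sum_mul]
      refine Finset.sum_congr rfl fun j hj => ?_
      have (l : ℕ) : (if l = i then C (f (sub l x)) * sizePow (sub l x) else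
          if l = j then C (g (sub l x)) * sizePow (sub l x) else sizePow (sub l x)) =
          (if l = i then C (f (sub i x)) else if l = j then C (g (sub j x)) else 1) *
            sizePow (sub l x) := by
        split_ifs with h1 h2
        · rw [h1]
        · rw [h2]
        · rw [one_mul]
      simp only [this, prod_mul_distrib]
      rw [prod_ite_ite_eq_mul_pow hi hj, one_pow, mul_one, map_mul])
  rw [weightedSeries, h]
  congr 1
  ext n
  rw [coeff_mk, coeff_ev_mul, tsum_eq_zero_add' ENNReal.summable,
    tsum_eq_zero_add' ENNReal.summable]
  have h0 : (range (0 + 1)).sigma (fun i => (range (0 + 1)).erase i) = ∅ := by decide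
  have h00 : (range 0).sigma (fun i => (range 0).erase i) = ∅ := rfl
  rw [h0, h00]
  simp only [sum_empty, map_zero, mul_zero, zero_add]
  refine tsum_congr fun d => ?_
  have (q : Σ _ : ℕ, ℕ) (hq : q ∈ (range (d + 1 + 1)).sigma fun i => (range (d + 1 + 1)).erase i) :
      ∏ l ∈ range (d + 1 + 1), gf ξ (fun x => if l = q.1 then C (f x) * sizePow x else
        if l = q.2 then C (g x) * sizePow x else sizePow x) =
        sizeSeries ξ ^ d * (weightedSeries ξ f * weightedSeries ξ g) := by
    have h2 (l : ℕ) : gf ξ (fun x => if l = q.1 then C (f x) * sizePow x else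
        if l = q.2 then C (g x) * sizePow x else sizePow x) =
        if l = q.1 then weightedSeries ξ f else
          if l = q.2 then weightedSeries ξ g else sizeSeries ξ := by
      split_ifs <;> rfl
    simp only [h2]
    rw [mem_sigma] at hq
    rw [prod_ite_ite_eq_mul_pow hq.1 hq.2, card_range, Nat.add_sub_cancel (n := d) (m := 2)]
    ring
  have hc : ((range (d + 1 + 1)).sigma fun i => (range (d + 1 + 1)).erase i).card =
      (d + 2) * (d + 1) := by
    rw [card_sigma, Finset.sum_congr rfl fun i hi => card_erase_of_mem hi]
    simp
  rw [Finset.sum_congr rfl this, sum_const, hc, coeff_derivative, coeff_derivative, map_nsmul,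
    nsmul_eq_mul]
  simp only [offspringSeries, coeff_mk]
  push_cast
  ring

theorem weightedSeries_genCount (k : ℕ) : weightedSeries ξ (genCount k) =
    (X * ev (sizeSeries ξ) (d⁄dX ℝ≥0∞ (offspringSeries ξ))) ^ k * sizeSeries ξ := by
  induction k with
  | zero =>
    have : genCount 0 = fun _ => 1 := funext genCount_zero
    rw [this, weightedSeries_one, pow_zero, one_mul]
  | succ k ih =>
    have : genCount (k + 1) = fun x => ∑ i ∈ range (x []), genCount k (sub i x) :=
      funext (genCount_succ k)
    rw [this, weightedSeries_sum_sub (measurable_genCount k), ih, pow_succ']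
    ring

theorem weightedSeries_pairCount {k : ℕ} (hk : 1 ≤ k) :
    weightedSeries ξ (pairCount k) = diag (offspringSeries ξ) *
      (C 2 * weightedSeries ξ (genCount k) + ∑ q ∈ splits k,
        X * (ev (sizeSeries ξ) (d⁄dX ℝ≥0∞ (d⁄dX ℝ≥0∞ (offspringSeries ξ))) *
          (weightedSeries ξ (genCount q.1) * weightedSeries ξ (genCount q.2)))) := by
  refine eq_diag_mul (sizeSeries_eq ξ) ?_
  have h : pairCount k = fun x => (∑ i ∈ range (x []), pairCount k (sub i x)) +
      (2 * genCount k x + ∑ q ∈ splits k, ∑ i ∈ range (x []), ∑ j ∈ (range (x [])).erase i,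
        genCount q.1 (sub i x) * genCount q.2 (sub j x)) := by
    ext x
    rw [pairCount_eq hk x, sum_comm (s := splits k)]
    simp only [sum_comm (s := splits k)]
    ring
  conv_lhs => rw [h]
  rw [weightedSeries_add (measurable_sum_sub (measurable_pairCount k)),
    weightedSeries_add ((measurable_genCount k).const_mul 2),
    weightedSeries_sum_sub (measurable_pairCount k),
    weightedSeries_const_mul _ (measurable_genCount k),
    weightedSeries_finset_sum (splits k) (f := fun q x => ∑ i ∈ range (x []),
      ∑ j ∈ (range (x [])).erase i, genCount q.1 (sub i x) * genCount q.2 (sub j x))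
      fun q => measurable_sum_sum_sub (measurable_genCount q.1)
      (measurable_genCount q.2)]
  simp only [weightedSeries_sum_sum_sub (measurable_genCount _) (measurable_genCount _)]

theorem coeff_weightedSeries_pairCount {k n : ℕ} (hk : 1 ≤ k) (hkn : k ≤ n) :
    coeff n (weightedSeries ξ (pairCount k)) =
      2 * coeff (n - k) (d⁄dX ℝ≥0∞ (offspringSeries ξ) ^ k * X * offspringSeries ξ ^ (n - k)) +
      (splits k).card * coeff (n - (k - 1))
        (d⁄dX ℝ≥0∞ (d⁄dX ℝ≥0∞ (offspringSeries ξ)) * d⁄dX ℝ≥0∞ (offspringSeries ξ) ^ (k - 2) *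
          X ^ 2 * offspringSeries ξ ^ (n - (k - 1))) := by
  set Φ := offspringSeries ξ
  set Q := sizeSeries ξ
  have hQ : Q = X * ev Q Φ := sizeSeries_eq ξ
  have h1 : diag Φ * (C 2 * weightedSeries ξ (genCount k)) =
      C 2 * (X ^ k * (ev Q (d⁄dX ℝ≥0∞ Φ ^ k * X) * diag Φ)) := by
    rw [weightedSeries_genCount, ev_mul, ev_pow, ev_X]
    ring
  have h2 (q : ℕ × ℕ) (hq : q ∈ splits k) : diag Φ * (X * (ev Q (d⁄dX ℝ≥0∞ (d⁄dX ℝ≥0∞ Φ)) *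
      (weightedSeries ξ (genCount q.1) * weightedSeries ξ (genCount q.2)))) =
      X ^ (k - 1) * (ev Q (d⁄dX ℝ≥0∞ (d⁄dX ℝ≥0∞ Φ) * d⁄dX ℝ≥0∞ Φ ^ (k - 2) * X ^ 2) *
        diag Φ) := by
    obtain ⟨a, b⟩ := q
    have hab : a + b + 2 = k := (mem_filter.1 hq).2
    have e1 : k - 1 = a + b + 1 := by omega
    have e2 : k - 2 = a + b := by omega
    rw [weightedSeries_genCount, weightedSeries_genCount, ev_mul, ev_mul, ev_pow, ev_X_pow, e1, e2]
    ring
  rw [weightedSeries_pairCount hk, mul_add, h1, mul_sum, Finset.sum_congr rfl h2, sum_const,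
    map_add, coeff_C_mul, map_nsmul, nsmul_eq_mul, coeff_X_pow_mul', coeff_X_pow_mul',
    if_pos hkn, if_pos (by omega), coeff_ev_mul_diag hQ, coeff_ev_mul_diag hQ]

end

section

variable (ξ : Measure ℕ)

/-- The probability that `N` independent offspring numbers add up to `j`. -/
noncomputable def walkMass (N j : ℕ) : ℝ := (coeff j (offspringSeries ξ ^ N)).toReal

theorem walkMass_nonneg (N j : ℕ) : 0 ≤ walkMass ξ N j := ENNReal.toReal_nonneg

theorem walkMass_one (j : ℕ) : walkMass ξ 1 j = ξ.real {j} := by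
  simp [walkMass, offspringSeries, measureReal_def]

/-- `h` is the span of the offspring distribution. -/
structure IsSpan (h : ℕ) : Prop where
  pos : 0 < h
  dvd : ∀ d, ξ.real {d} ≠ 0 → h ∣ d
  exists_eq : ∀ t : ℝ, (∀ d : ℕ, ξ.real {d} ≠ 0 → Real.cos (t * d) = 1) →
    ∃ m : ℤ, t * h = m * (2 * Real.pi)

variable {ξ} in
theorem exists_isSpan {b : ℕ} (hb : b ≠ 0) (hbp : ξ.real {b} ≠ 0) : ∃ h, IsSpan ξ h := by
  obtain ⟨g, hg⟩ := Int.subgroup_cyclic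
    (AddSubgroup.closure {m : ℤ | ∃ d : ℕ, ξ.real {d} ≠ 0 ∧ m = d})
  have hdvd (d : ℕ) (hd : ξ.real {d} ≠ 0) : g.natAbs ∣ d := by
    have : (d : ℤ) ∈ AddSubgroup.closure {m : ℤ | ∃ d : ℕ, ξ.real {d} ≠ 0 ∧ m = d} :=
      AddSubgroup.subset_closure ⟨d, hd, rfl⟩
    rw [hg, AddSubgroup.mem_closure_singleton] at this
    obtain ⟨m, hm⟩ := this
    rw [← Int.natCast_dvd_natCast, Int.natAbs_dvd]
    exact ⟨m, by rw [← hm, smul_eq_mul, mul_comm]⟩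
  refine ⟨g.natAbs, Nat.pos_of_ne_zero fun h0 => ?_, hdvd, fun t ht => ?_⟩
  · have := hdvd b hbp
    rw [h0, zero_dvd_iff] at this
    exact hb this
  · have key : ∀ m ∈ AddSubgroup.closure {m : ℤ | ∃ d : ℕ, ξ.real {d} ≠ 0 ∧ m = d},
        ∃ k : ℤ, t * m = k * (2 * Real.pi) := by
      intro m hm
      induction hm using AddSubgroup.closure_induction with
      | mem m hm =>
        obtain ⟨d, hd, rfl⟩ := hm
        obtain ⟨k, hk⟩ := (Real.cos_eq_one_iff _).1 (ht d hd)
        exact ⟨k, by rw [hk]; simp⟩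
      | zero => exact ⟨0, by simp⟩
      | add m n _ _ h1 h2 =>
        obtain ⟨k, hk⟩ := h1
        obtain ⟨l, hl⟩ := h2
        exact ⟨k + l, by push_cast; linear_combination hk + hl⟩
      | neg m _ h1 =>
        obtain ⟨k, hk⟩ := h1
        exact ⟨-k, by push_cast; linear_combination -hk⟩
    have hgm : (g.natAbs : ℤ) ∈
        AddSubgroup.closure {m : ℤ | ∃ d : ℕ, ξ.real {d} ≠ 0 ∧ m = d} := by
      rw [hg, AddSubgroup.mem_closure_singleton]
      rcases Int.natAbs_eq g with h | h
      · exact ⟨1, by simpa using h⟩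
      · exact ⟨-1, by simp only [smul_eq_mul]; omega⟩
    obtain ⟨k, hk⟩ := key _ hgm
    exact ⟨k, by rw [← hk, Int.cast_natCast]⟩

variable [IsProbabilityMeasure ξ]

theorem tsum_coeff_offspringSeries : ∑' d, coeff d (offspringSeries ξ) = 1 := by
  have h := lintegral_countable' (μ := ξ) fun _ => 1
  simpa [offspringSeries] using h.symm

theorem tsum_coeff_offspringSeries_pow (N : ℕ) :
    ∑' j, coeff j (offspringSeries ξ ^ N) = 1 := by
  rw [tsum_coeff_pow, tsum_coeff_offspringSeries, one_pow]

theorem coeff_offspringSeries_pow_ne_top (N j : ℕ) : coeff j (offspringSeries ξ ^ N) ≠ ⊤ :=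
  ENNReal.ne_top_of_tsum_ne_top (by rw [tsum_coeff_offspringSeries_pow ξ N]; simp) j

theorem ofReal_walkMass (N j : ℕ) :
    ENNReal.ofReal (walkMass ξ N j) = coeff j (offspringSeries ξ ^ N) :=
  ENNReal.ofReal_toReal (coeff_offspringSeries_pow_ne_top ξ N j)

theorem walkMass_succ (N j : ℕ) :
    walkMass ξ (N + 1) j = ∑ x ∈ antidiagonal j, walkMass ξ N x.1 * ξ.real {x.2} := by
  rw [walkMass, pow_succ, coeff_mul, ENNReal.toReal_sum]
  · refine Finset.sum_congr rfl fun x _ => ?_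
    rw [ENNReal.toReal_mul]
    simp [walkMass, offspringSeries, measureReal_def]
  · intro x _
    refine ENNReal.mul_ne_top (coeff_offspringSeries_pow_ne_top ξ _ _) ?_
    simp [offspringSeries]

theorem summable_walkMass (N : ℕ) : Summable (walkMass ξ N) :=
  ENNReal.summable_toReal (by rw [tsum_coeff_offspringSeries_pow]; simp)

theorem tsum_walkMass (N : ℕ) : ∑' j, walkMass ξ N j = 1 := by
  simp only [walkMass]
  rw [← ENNReal.tsum_toReal_eq (coeff_offspringSeries_pow_ne_top ξ N),
    tsum_coeff_offspringSeries_pow, ENNReal.toReal_one]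

/-- The characteristic function of the offspring distribution. -/
noncomputable def phi (t : ℝ) : ℂ := ∑' d : ℕ, (ξ.real {d} : ℂ) * Complex.exp (t * d * Complex.I)

theorem norm_exp_mul_I (t : ℝ) (d : ℕ) : ‖Complex.exp (t * d * Complex.I)‖ = 1 := by
  have := Complex.norm_exp_ofReal_mul_I (t * d)
  push_cast at this
  exact this

theorem summable_real : Summable fun d : ℕ => ξ.real {d} := by
  simpa only [← walkMass_one ξ] using summable_walkMass ξ 1

theorem tsum_real : ∑' d : ℕ, ξ.real {d} = 1 := by
  simpa only [walkMass_one] using tsum_walkMass ξ 1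

theorem summable_norm_walkMass_mul_exp (N : ℕ) (t : ℝ) :
    Summable fun j : ℕ => ‖(walkMass ξ N j : ℂ) * Complex.exp (t * j * Complex.I)‖ := by
  simpa [norm_exp_mul_I, abs_of_nonneg (walkMass_nonneg ξ N _)] using summable_walkMass ξ N

theorem summable_norm_real_mul_exp (t : ℝ) :
    Summable fun j : ℕ => ‖(ξ.real {j} : ℂ) * Complex.exp (t * j * Complex.I)‖ := by
  simpa only [walkMass_one] using summable_norm_walkMass_mul_exp ξ 1 t

theorem tsum_walkMass_mul_exp (N : ℕ) (t : ℝ) :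
    ∑' j : ℕ, (walkMass ξ N j : ℂ) * Complex.exp (t * j * Complex.I) = phi ξ t ^ N := by
  induction N with
  | zero =>
    rw [tsum_eq_single 0]
    · simp [walkMass]
    · intro j hj
      simp [walkMass, coeff_one, hj]
  | succ N ih =>
    rw [pow_succ, ← ih, phi, tsum_mul_tsum_eq_tsum_sum_antidiagonal_of_summable_norm
      (summable_norm_walkMass_mul_exp ξ N t) (summable_norm_real_mul_exp ξ t)]
    refine tsum_congr fun j => ?_
    rw [walkMass_succ, Complex.ofReal_sum, Finset.sum_mul]
    refine Finset.sum_congr rfl fun x hx => ?_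
    rw [← mem_antidiagonal.1 hx]
    push_cast
    rw [mul_add, add_mul, Complex.exp_add]
    ring

theorem continuous_phi : Continuous (phi ξ) := by
  refine continuous_tsum (u := fun d => ξ.real {d}) (fun d => by fun_prop) (summable_real ξ)
    fun d t => ?_
  rw [norm_mul, norm_exp_mul_I, mul_one, Complex.norm_of_nonneg measureReal_nonneg]

theorem summable_real_mul_cos (t : ℝ) :
    Summable fun d : ℕ => ξ.real {d} * (1 - Real.cos (t * d)) := by
  refine Summable.of_nonneg_of_le (fun d => ?_) (fun d => ?_) ((summable_real ξ).mul_left 2)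
  · exact mul_nonneg measureReal_nonneg (by linarith [Real.cos_le_one (t * d)])
  · rw [mul_comm]
    exact mul_le_mul_of_nonneg_right (by linarith [Real.neg_one_le_cos (t * d)])
      measureReal_nonneg

theorem one_sub_re_phi (t : ℝ) :
    1 - (phi ξ t).re = ∑' d : ℕ, ξ.real {d} * (1 - Real.cos (t * d)) := by
  have h : (phi ξ t).re = ∑' d : ℕ, ξ.real {d} * Real.cos (t * d) := by
    rw [phi, Complex.re_tsum (summable_norm_real_mul_exp ξ t).of_norm]
    refine tsum_congr fun d => ?_
    rw [Complex.re_ofReal_mul, ← Complex.exp_ofReal_mul_I_re]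
    push_cast
    rfl
  have h2 : Summable fun d : ℕ => ξ.real {d} * Real.cos (t * d) := by
    have := (summable_real ξ).sub (summable_real_mul_cos ξ t)
    refine this.congr fun d => by ring
  rw [h]
  nth_rw 1 [← tsum_real ξ]
  rw [← (summable_real ξ).tsum_sub h2]
  exact tsum_congr fun d => by ring

theorem real_mul_one_sub_cos_le (t : ℝ) (d : ℕ) :
    ξ.real {d} * (1 - Real.cos (t * d)) ≤ 1 - (phi ξ t).re := by
  rw [one_sub_re_phi]
  exact (summable_real_mul_cos ξ t).le_tsum d fun d _ =>
    mul_nonneg measureReal_nonneg (by linarith [Real.cos_le_one (t * d)])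

theorem norm_phi_sub_le (t : ℝ) : ‖phi ξ t - ξ.real {0}‖ ≤ 1 - ξ.real {0} := by
  have h1 : phi ξ t - ξ.real {0} =
      ∑' d : ℕ, (ξ.real {d + 1} : ℂ) * Complex.exp (t * (d + 1 : ℕ) * Complex.I) := by
    rw [phi, (summable_norm_real_mul_exp ξ t).of_norm.tsum_eq_zero_add]
    simp
  have h2 : 1 - ξ.real {0} = ∑' d : ℕ, ξ.real {d + 1} := by
    rw [← tsum_real ξ, (summable_real ξ).tsum_eq_zero_add]
    ring
  rw [h1, h2]
  refine tsum_of_norm_bounded ((summable_nat_add_iff 1).2 (summable_real ξ)).hasSum fun d => ?_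
  rw [norm_mul, norm_exp_mul_I, mul_one, Complex.norm_of_nonneg measureReal_nonneg]

theorem norm_phi_sq_le (t : ℝ) :
    ‖phi ξ t‖ ^ 2 ≤ 1 - 2 * ξ.real {0} * (1 - (phi ξ t).re) := by
  have h := norm_phi_sub_le ξ t
  have h2 := pow_le_pow_left₀ (norm_nonneg _) h 2
  rw [← Complex.normSq_eq_norm_sq, Complex.normSq_apply] at h2 ⊢
  simp only [Complex.sub_re, Complex.sub_im, Complex.ofReal_re, Complex.ofReal_im, sub_zero] at h2
  nlinarith

variable {ξ}

theorem IsSpan.dvd_of_walkMass_ne_zero {h : ℕ} (hh : IsSpan ξ h) {N j : ℕ}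
    (hj : walkMass ξ N j ≠ 0) : h ∣ j := by
  induction N generalizing j with
  | zero =>
    by_cases h0 : j = 0
    · simp [h0]
    · simp [walkMass, coeff_one, h0] at hj
  | succ N ih =>
    rw [walkMass_succ] at hj
    obtain ⟨x, hx, hne⟩ := Finset.exists_ne_zero_of_sum_ne_zero hj
    rw [← mem_antidiagonal.1 hx]
    exact dvd_add (ih (left_ne_zero_of_mul hne)) (hh.dvd _ (right_ne_zero_of_mul hne))

theorem IsSpan.exists_mul_sq_le {h : ℕ} (hh : IsSpan ξ h) {b : ℕ} (hb : b ≠ 0)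
    (hbp : ξ.real {b} ≠ 0) :
    ∃ κ > 0, ∀ t : ℝ, |t| ≤ Real.pi / h → κ * t ^ 2 ≤ 1 - (phi ξ t).re := by
  have hπ := Real.pi_pos
  have hh0 : (0 : ℝ) < h := Nat.cast_pos.2 hh.pos
  have hb0 : (0 : ℝ) < b := Nat.cast_pos.2 (Nat.pos_of_ne_zero hb)
  have hp0 : 0 < ξ.real {b} := lt_of_le_of_ne measureReal_nonneg hbp.symm
  set K : Set ℝ := Set.Icc (-(Real.pi / h)) (Real.pi / h) ∩ {t | Real.pi / b ≤ |t|}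
  have hK : IsCompact K := isCompact_Icc.inter_right (isClosed_le continuous_const continuous_abs)
  have hcont : ContinuousOn (fun t => 1 - (phi ξ t).re) K :=
    (continuous_const.sub (Complex.continuous_re.comp (continuous_phi ξ))).continuousOn
  obtain ⟨m, hm, hmK⟩ := hK.exists_forall_le' hcont (a := 0) fun t ht => by
    by_contra hle
    have hcos (d : ℕ) (hd : ξ.real {d} ≠ 0) : Real.cos (t * d) = 1 := by
      have h1 := (real_mul_one_sub_cos_le ξ t d).trans (not_lt.1 hle)
      have h2 : 0 < ξ.real {d} := lt_of_le_of_ne measureReal_nonneg hd.symm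
      have h3 := nonpos_of_mul_nonpos_right h1 h2
      linarith [Real.cos_le_one (t * d)]
    obtain ⟨k, hk⟩ := hh.exists_eq t hcos
    have h1 : |t * h| ≤ Real.pi := by
      rw [abs_mul, abs_of_pos hh0, ← le_div_iff₀ hh0]
      exact abs_le.2 ht.1
    rw [hk, abs_mul, abs_of_pos (by positivity : 0 < 2 * Real.pi)] at h1
    have h2 : |(k : ℝ)| < 1 := by nlinarith
    have h3 : k = 0 := by
      rw [← Int.cast_abs] at h2
      exact Int.abs_lt_one_iff.1 (by exact_mod_cast h2)
    rw [h3, Int.cast_zero, zero_mul] at hk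
    have h4 : t = 0 := (mul_eq_zero.1 hk).resolve_right hh0.ne'
    have h5 : Real.pi / b ≤ |t| := ht.2
    rw [h4, abs_zero] at h5
    exact absurd h5 (not_le.2 (by positivity))
  refine ⟨min (ξ.real {b} * (2 / Real.pi ^ 2 * b ^ 2)) (m * h ^ 2 / Real.pi ^ 2),
    by positivity, fun t ht => ?_⟩
  by_cases htb : Real.pi / b ≤ |t|
  · calc _ ≤ m * h ^ 2 / Real.pi ^ 2 * t ^ 2 := by gcongr; exact min_le_right _ _
      _ = m * (|t| * h / Real.pi) ^ 2 := by rw [div_pow, mul_pow, sq_abs]; ring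
      _ ≤ m * 1 ^ 2 := by
        gcongr
        rw [div_le_one hπ, ← le_div_iff₀ hh0]
        exact ht
      _ = m := by ring
      _ ≤ _ := hmK t ⟨abs_le.1 ht, htb⟩
  · have h1 : |t * b| ≤ Real.pi := by
      rw [abs_mul, abs_of_pos hb0, ← le_div_iff₀ hb0]
      exact (not_le.1 htb).le
    calc _ ≤ ξ.real {b} * (2 / Real.pi ^ 2 * b ^ 2) * t ^ 2 := by gcongr; exact min_le_left _ _
      _ = ξ.real {b} * (2 / Real.pi ^ 2 * (t * b) ^ 2) := by ring
      _ ≤ ξ.real {b} * (1 - Real.cos (t * b)) := by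
        gcongr
        linarith [Real.cos_le_one_sub_mul_cos_sq h1]
      _ ≤ _ := real_mul_one_sub_cos_le ξ t b

theorem IsSpan.exists_norm_phi_pow_le {h : ℕ} (hh : IsSpan ξ h) {b : ℕ} (hb : b ≠ 0)
    (hbp : ξ.real {b} ≠ 0) (h0 : ξ.real {0} ≠ 0) :
    ∃ κ > 0, ∀ t : ℝ, |t| ≤ Real.pi / h → ∀ N : ℕ,
      ‖phi ξ t ^ N‖ ≤ Real.exp (-(κ * N) * t ^ 2) := by
  obtain ⟨κ, hκ, H⟩ := hh.exists_mul_sq_le hb hbp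
  have hp0 : 0 < ξ.real {0} := lt_of_le_of_ne measureReal_nonneg h0.symm
  refine ⟨ξ.real {0} * κ, by positivity, fun t ht N => ?_⟩
  have h1 : ‖phi ξ t‖ ^ 2 ≤ Real.exp (-(ξ.real {0} * κ) * t ^ 2) ^ 2 := by
    rw [← Real.exp_nat_mul]
    refine (norm_phi_sq_le ξ t).trans (le_trans ?_ (Real.add_one_le_exp _))
    have := mul_le_mul_of_nonneg_left (H t ht) hp0.le
    push_cast
    linarith
  have h2 := (sq_le_sq₀ (norm_nonneg _) (Real.exp_pos _).le).1 h1
  rw [norm_pow]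
  refine (pow_le_pow_left₀ (norm_nonneg _) h2 N).trans_eq ?_
  rw [← Real.exp_nat_mul]
  ring_nf

theorem integral_exp_eq_zero {h : ℕ} (hh : 0 < h) {m : ℤ} (hm : m ≠ 0) :
    ∫ t in (-(Real.pi / h))..(Real.pi / h), Complex.exp (h * m * Complex.I * t) = 0 := by
  have hh0 : (h : ℂ) ≠ 0 := Nat.cast_ne_zero.2 hh.ne'
  have hm0 : (m : ℂ) ≠ 0 := Int.cast_ne_zero.2 hm
  rw [integral_exp_mul_complex (by simp [hh0, hm0])]
  have h1 : (h : ℂ) * m * Complex.I * (Real.pi / h : ℝ) =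
      h * m * Complex.I * (-(Real.pi / h) : ℝ) + m * (2 * Real.pi * Complex.I) := by
    push_cast
    field_simp
    ring
  rw [h1, Complex.exp_add, Complex.exp_int_mul_two_pi_mul_I, mul_one, sub_self, zero_div]

/-- Fourier inversion over one period. -/
theorem IsSpan.walkMass_eq {h : ℕ} (hh : IsSpan ξ h) {N j : ℕ} (hj : h ∣ j) :
    ((2 * Real.pi / h : ℝ) : ℂ) * walkMass ξ N j =
      ∫ t in (-(Real.pi / h))..(Real.pi / h), phi ξ t ^ N * Complex.exp (-(t * j * Complex.I)) := by
  have hterm (t : ℝ) (l : ℕ) : ‖(walkMass ξ N l : ℂ) * Complex.exp (t * l * Complex.I) *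
      Complex.exp (-(t * j * Complex.I))‖ = walkMass ξ N l := by
    rw [norm_mul, norm_mul, norm_exp_mul_I, Complex.exp_neg, norm_inv, norm_exp_mul_I]
    simp [abs_of_nonneg (walkMass_nonneg ξ N l)]
  have hs := intervalIntegral.hasSum_integral_of_dominated_convergence
    (μ := volume) (a := -(Real.pi / h)) (b := Real.pi / h)
    (F := fun (l : ℕ) (t : ℝ) => (walkMass ξ N l : ℂ) * Complex.exp (t * l * Complex.I) *
      Complex.exp (-(t * j * Complex.I)))
    (f := fun t => phi ξ t ^ N * Complex.exp (-(t * j * Complex.I)))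
    (fun l _ => walkMass ξ N l)
    (fun l => by
      refine Continuous.aestronglyMeasurable ?_
      fun_prop)
    (fun l => .of_forall fun t _ => (hterm t l).le)
    (.of_forall fun t _ => summable_walkMass ξ N)
    (by simp)
    (.of_forall fun t _ => by
      rw [← tsum_walkMass_mul_exp ξ N t]
      exact ((summable_norm_walkMass_mul_exp ξ N t).of_norm.hasSum).mul_right _)
  refine HasSum.unique ?_ hs
  have hne (l : ℕ) (hl : l ≠ j) : ∫ t in (-(Real.pi / h))..(Real.pi / h),
      (walkMass ξ N l : ℂ) * Complex.exp (t * l * Complex.I) *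
        Complex.exp (-(t * j * Complex.I)) = 0 := by
    by_cases h0 : walkMass ξ N l = 0
    · simp [h0]
    · obtain ⟨a, ha⟩ := hh.dvd_of_walkMass_ne_zero h0
      obtain ⟨c, hc⟩ := hj
      have hac : (a : ℤ) - c ≠ 0 := by
        intro hac
        have : a = c := by omega
        exact hl (by rw [ha, hc, this])
      have := integral_exp_eq_zero hh.pos hac
      rw [← mul_zero (walkMass ξ N l : ℂ), ← this, ← intervalIntegral.integral_const_mul]
      refine intervalIntegral.integral_congr fun t _ => ?_
      rw [mul_assoc, ← Complex.exp_add, ha, hc]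
      push_cast
      ring_nf
  have hself : ∫ t in (-(Real.pi / h))..(Real.pi / h),
      (walkMass ξ N j : ℂ) * Complex.exp (t * j * Complex.I) *
        Complex.exp (-(t * j * Complex.I)) = ((2 * Real.pi / h : ℝ) : ℂ) * walkMass ξ N j := by
    have (t : ℝ) : (walkMass ξ N j : ℂ) * Complex.exp (t * j * Complex.I) *
        Complex.exp (-(t * j * Complex.I)) = walkMass ξ N j := by
      rw [mul_assoc, ← Complex.exp_add, add_neg_cancel, Complex.exp_zero, mul_one]
    simp only [this]
    rw [intervalIntegral.integral_const, Complex.real_smul]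
    push_cast
    ring
  rw [← hself]
  exact hasSum_single j hne

theorem IsSpan.exists_walkMass_le {h : ℕ} (hh : IsSpan ξ h) {b : ℕ} (hb : b ≠ 0)
    (hbp : ξ.real {b} ≠ 0) (h0 : ξ.real {0} ≠ 0) :
    ∃ c : ℝ, 0 ≤ c ∧ ∀ N j : ℕ, 1 ≤ N → walkMass ξ N j ≤ c / √N := by
  obtain ⟨κ, hκ, H⟩ := hh.exists_norm_phi_pow_le hb hbp h0
  have hh0 : (0 : ℝ) < h := Nat.cast_pos.2 hh.pos
  have hπ := Real.pi_pos
  refine ⟨h / (2 * Real.pi) * √(Real.pi / κ), by positivity, fun N j hN => ?_⟩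
  have hN0 : (0 : ℝ) < N := Nat.cast_pos.2 hN
  by_cases hj : h ∣ j
  swap
  · have : walkMass ξ N j = 0 := by
      by_contra hne
      exact hj (hh.dvd_of_walkMass_ne_zero hne)
    rw [this]
    positivity
  have hle : (2 * Real.pi / h) * walkMass ξ N j ≤ √(Real.pi / (κ * N)) := by
    have h1 := congrArg norm (hh.walkMass_eq (N := N) hj)
    rw [norm_mul, Complex.norm_real, Complex.norm_real, Real.norm_of_nonneg (by positivity),
      Real.norm_of_nonneg (walkMass_nonneg ξ N j)] at h1
    rw [h1, ← integral_gaussian]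
    have hint := integrable_exp_neg_mul_sq (b := κ * N) (by positivity)
    have hle : -(Real.pi / h) ≤ Real.pi / h := by
      have : 0 < Real.pi / h := by positivity
      linarith
    refine (intervalIntegral.norm_integral_le_of_norm_le hle (.of_forall fun t ht => ?_)
      hint.intervalIntegrable).trans ?_
    · rw [norm_mul, Complex.exp_neg, norm_inv, norm_exp_mul_I, inv_one, mul_one]
      exact H t (abs_le.2 ⟨ht.1.le, ht.2⟩) N
    · rw [intervalIntegral.integral_of_le hle]
      exact setIntegral_le_integral hint (.of_forall fun t => (Real.exp_pos _).le)
  rw [← div_div, Real.sqrt_div (by positivity)] at hle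
  rw [div_mul_eq_mul_div, div_le_iff₀ hh0] at hle
  rw [div_mul_eq_mul_div, div_div, le_div_iff₀ (by positivity)]
  have : 0 < √(N : ℝ) := by positivity
  rw [div_mul_eq_mul_div, le_div_iff₀ this] at hle
  linarith

end

section

open Filter Topology

theorem exists_pos_forall_le {f : ℕ → ℝ} {P : ℕ → Prop} (hf : ∀ N, P N → 0 < f N) {c : ℝ}
    (hc : 0 < c) (N₀ : ℕ) (h : ∀ N, N₀ ≤ N → P N → c ≤ f N) :
    ∃ c > 0, ∀ N, P N → c ≤ f N := by
  induction N₀ generalizing c with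
  | zero => exact ⟨c, hc, fun N => h N N.zero_le⟩
  | succ N₀ ih =>
    by_cases hP : P N₀
    · refine ih (lt_min hc (hf N₀ hP)) fun N hN hPN => ?_
      rcases hN.eq_or_lt with rfl | hlt
      · exact min_le_right _ _
      · exact (min_le_left _ _).trans (h N hlt hPN)
    · refine ih hc fun N hN hPN => ?_
      rcases hN.eq_or_lt with rfl | hlt
      · exact absurd hPN hP
      · exact h N hlt hPN

variable {ξ : Measure ℕ} [IsProbabilityMeasure ξ]

theorem integrable_natCast (hL2 : MemLp (fun i : ℕ => (i : ℝ)) 2 ξ) :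
    Integrable (fun i : ℕ => (i : ℝ)) ξ :=
  hL2.integrable one_le_two

theorem real_zero_ne_zero (hL2 : MemLp (fun i : ℕ => (i : ℝ)) 2 ξ)
    (hmean : ∫ i : ℕ, (i : ℝ) ∂ξ = 1) (hvar : 0 < Var[fun i : ℕ => (i : ℝ); ξ]) :
    ξ.real {0} ≠ 0 := by
  intro h0
  rw [measureReal_eq_zero_iff] at h0
  have hae : ∀ᵐ i : ℕ ∂ξ, (0 : ℝ) ≤ i - 1 := by
    have : ∀ᵐ i : ℕ ∂ξ, i ≠ 0 := by
      rw [ae_iff]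
      simpa using h0
    filter_upwards [this] with i hi
    have : (1 : ℝ) ≤ i := by exact_mod_cast Nat.one_le_iff_ne_zero.2 hi
    linarith
  have hint : Integrable (fun i : ℕ => (i : ℝ) - 1) ξ :=
    (integrable_natCast hL2).sub (integrable_const 1)
  have hzero : ∫ i : ℕ, ((i : ℝ) - 1) ∂ξ = 0 := by
    rw [integral_sub (integrable_natCast hL2) (integrable_const 1), hmean]
    simp
  have h1 := (integral_eq_zero_iff_of_nonneg_ae hae hint).1 hzero
  rw [variance_eq_integral hL2.aestronglyMeasurable.aemeasurable, hmean] at hvar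
  refine hvar.ne' (integral_eq_zero_of_ae ?_)
  filter_upwards [h1] with i hi
  simp only [Pi.zero_apply] at hi
  simp [hi]

theorem exists_real_ne_zero (hmean : ∫ i : ℕ, (i : ℝ) ∂ξ = 1) :
    ∃ b : ℕ, b ≠ 0 ∧ ξ.real {b} ≠ 0 := by
  by_contra! h
  have : ∫ i : ℕ, (i : ℝ) ∂ξ = 0 := by
    refine integral_eq_zero_of_ae ?_
    rw [Filter.EventuallyEq, ae_iff_of_countable]
    intro i hi
    by_contra hne
    refine hi ((measureReal_eq_zero_iff).1 (h i fun h0 => hne ?_))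
    simp [h0]
  rw [hmean] at this
  exact one_ne_zero this

theorem tendsto_phi_pow (hL2 : MemLp (fun i : ℕ => (i : ℝ)) 2 ξ)
    (hmean : ∫ i : ℕ, (i : ℝ) ∂ξ = 1) (hvar : 0 < Var[fun i : ℕ => (i : ℝ); ξ]) (s : ℝ) :
    Tendsto (fun N : ℕ => (phi ξ (s / √N) * Complex.exp (-((s / √N : ℝ) * Complex.I))) ^ N) atTop
      (𝓝 (Real.exp (-(Var[fun i : ℕ => (i : ℝ); ξ] / 2) * s ^ 2) : ℂ)) := by
  set v := Var[fun i : ℕ => (i : ℝ); ξ] with hv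
  have hσ : 0 < √v := Real.sqrt_pos.2 hvar
  have hσ2 : √v ^ 2 = v := Real.sq_sqrt hvar.le
  set Y : ℕ → ℝ := fun i => ((i : ℝ) - 1) / √v
  have hY : AEMeasurable Y ξ := (measurable_from_top).aemeasurable
  have h0 : ξ[Y] = 0 := by
    simp only [Y]
    rw [integral_div, integral_sub (integrable_natCast hL2) (integrable_const 1), hmean]
    simp
  have h1 : ξ[Y ^ 2] = 1 := by
    have hv2 := variance_eq_integral (μ := ξ) hL2.aestronglyMeasurable.aemeasurable
    rw [hmean, ← hv] at hv2
    simp only [Y, Pi.pow_apply, div_pow]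
    rw [integral_div, ← hv2, hσ2, div_self hvar.ne']
  have hchar (u : ℝ) : charFun (ξ.map Y) (u * √v) =
      phi ξ u * Complex.exp (-((u : ℝ) * Complex.I)) := by
    rw [charFun_apply_real, integral_map hY (by fun_prop), integral_countable, phi,
      ← tsum_mul_right]
    · refine tsum_congr fun d => ?_
      rw [Complex.real_smul, mul_assoc (ξ.real {d} : ℂ), ← Complex.exp_add]
      congr 2
      have : ((√v : ℝ) : ℂ) ≠ 0 := Complex.ofReal_ne_zero.2 hσ.ne'
      simp only [Y]
      push_cast
      field_simp
      ring
    · refine (integrable_const (1 : ℝ)).mono' (measurable_from_top).aestronglyMeasurable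
        (.of_forall fun d => ?_)
      have := Complex.norm_exp_ofReal_mul_I (u * √v * Y d)
      push_cast at this ⊢
      exact this.le
  have h := tendsto_charFun_inv_sqrt_mul_pow hY h0 h1 (s * √v)
  have e (N : ℕ) : (√(N : ℝ))⁻¹ * (s * √v) = s / √N * √v := by ring
  simp only [e, hchar] at h
  convert! h using 2
  rw [Complex.ofReal_exp]
  congr 1
  rw [← Complex.ofReal_pow, mul_pow, hσ2]
  push_cast
  ring

theorem IsSpan.tendsto_integral {h : ℕ} (hh : IsSpan ξ h)
    (hL2 : MemLp (fun i : ℕ => (i : ℝ)) 2 ξ) (hmean : ∫ i : ℕ, (i : ℝ) ∂ξ = 1)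
    (hvar : 0 < Var[fun i : ℕ => (i : ℝ); ξ]) :
    Tendsto (fun N : ℕ => (√N : ℂ) * ∫ t in (-(Real.pi / h))..(Real.pi / h),
      (phi ξ t * Complex.exp (-((t : ℝ) * Complex.I))) ^ N * Complex.exp (t * Complex.I)) atTop
      (𝓝 (∫ s : ℝ, (Real.exp (-(Var[fun i : ℕ => (i : ℝ); ξ] / 2) * s ^ 2) : ℂ))) := by
  obtain ⟨b, hb, hbp⟩ := exists_real_ne_zero hmean
  obtain ⟨κ, hκ, H⟩ := hh.exists_norm_phi_pow_le hb hbp (real_zero_ne_zero hL2 hmean hvar)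
  have hr : 0 < Real.pi / h := div_pos Real.pi_pos (Nat.cast_pos.2 hh.pos)
  set r := Real.pi / h
  set f : ℕ → ℝ → ℂ := fun N t =>
    (phi ξ t * Complex.exp (-((t : ℝ) * Complex.I))) ^ N * Complex.exp (t * Complex.I) with hf
  have hfc (N : ℕ) : Continuous (f N) := by
    have := continuous_phi ξ
    fun_prop
  have key : Tendsto (fun N : ℕ => ∫ s : ℝ, (Set.Ioc (-r * √N) (r * √N)).indicator
      (fun s => f N (s / √N)) s) atTop
      (𝓝 (∫ s : ℝ, (Real.exp (-(Var[fun i : ℕ => (i : ℝ); ξ] / 2) * s ^ 2) : ℂ))) := by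
    refine tendsto_integral_filter_of_dominated_convergence (fun s => Real.exp (-κ * s ^ 2))
      (.of_forall fun N => ?_) ?_ (integrable_exp_neg_mul_sq hκ) (.of_forall fun s => ?_)
    · exact (((hfc N).comp (continuous_id.div_const _)).aestronglyMeasurable).indicator
        measurableSet_Ioc
    · filter_upwards [eventually_ge_atTop 1] with N hN
      refine .of_forall fun s => ?_
      have hN0 : (0 : ℝ) < N := Nat.cast_pos.2 hN
      have hsq : 0 < √(N : ℝ) := Real.sqrt_pos.2 hN0
      by_cases hs : s ∈ Set.Ioc (-r * √N) (r * √N)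
      · rw [Set.indicator_of_mem hs, hf]
        have hs' : |s / √N| ≤ r := by
          rw [abs_le, le_div_iff₀ hsq, div_le_iff₀ hsq]
          exact ⟨hs.1.le, hs.2⟩
        have h1 := H _ hs' N
        have e1 (t : ℝ) : ‖Complex.exp (t * Complex.I)‖ = 1 := Complex.norm_exp_ofReal_mul_I t
        simp only
        rw [norm_mul, e1, mul_one, mul_pow, norm_mul, norm_pow (Complex.exp _), Complex.exp_neg,
          norm_inv, e1, inv_one, one_pow, mul_one]
        refine h1.trans_eq ?_
        rw [div_pow, Real.sq_sqrt hN0.le]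
        congr 1
        field_simp
      · rw [Set.indicator_of_notMem hs, norm_zero]
        exact (Real.exp_pos _).le
    · have hlim : Tendsto (fun N : ℕ => f N (s / √N)) atTop
          (𝓝 (Real.exp (-(Var[fun i : ℕ => (i : ℝ); ξ] / 2) * s ^ 2) : ℂ)) := by
        have h0 : Tendsto (fun N : ℕ => s / √(N : ℝ)) atTop (𝓝 0) :=
          tendsto_const_nhds.div_atTop
            (Real.tendsto_sqrt_atTop.comp tendsto_natCast_atTop_atTop)
        have hc : Continuous fun t : ℝ => Complex.exp (t * Complex.I) := by fun_prop
        have h1 := (hc.tendsto 0).comp h0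
        simp only [Complex.ofReal_zero, zero_mul, Complex.exp_zero] at h1
        have := (tendsto_phi_pow hL2 hmean hvar s).mul h1
        rwa [mul_one] at this
      refine hlim.congr' ?_
      have hbig : Tendsto (fun N : ℕ => r * √(N : ℝ)) atTop atTop :=
        (Real.tendsto_sqrt_atTop.comp tendsto_natCast_atTop_atTop).const_mul_atTop hr
      filter_upwards [hbig.eventually_gt_atTop |s|] with N hN
      rw [Set.indicator_of_mem]
      have := abs_lt.1 hN
      exact ⟨by linarith, this.2.le⟩
  refine key.congr' ?_
  filter_upwards [eventually_ge_atTop 1] with N hN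
  have hN0 : (0 : ℝ) < N := Nat.cast_pos.2 hN
  have hsq : 0 < √(N : ℝ) := Real.sqrt_pos.2 hN0
  have hle : -r * √N ≤ r * √N := by nlinarith
  rw [integral_indicator measurableSet_Ioc, ← intervalIntegral.integral_of_le hle,
    intervalIntegral.integral_comp_div (f N) hsq.ne', mul_div_cancel_right₀ _ hsq.ne',
    mul_div_cancel_right₀ _ hsq.ne', Complex.real_smul]

theorem exists_le_walkMass (hL2 : MemLp (fun i : ℕ => (i : ℝ)) 2 ξ)
    (hmean : ∫ i : ℕ, (i : ℝ) ∂ξ = 1) (hvar : 0 < Var[fun i : ℕ => (i : ℝ); ξ]) :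
    ∃ c > 0, ∀ N : ℕ, 1 ≤ N → walkMass ξ N (N - 1) ≠ 0 → c / √N ≤ walkMass ξ N (N - 1) := by
  obtain ⟨b, hb, hbp⟩ := exists_real_ne_zero hmean
  obtain ⟨h, hh⟩ := exists_isSpan hb hbp
  have hh0 : (0 : ℝ) < h := Nat.cast_pos.2 hh.pos
  have hπ := Real.pi_pos
  have hlim := (hh.tendsto_integral hL2 hmean hvar).norm
  set v := Var[fun i : ℕ => (i : ℝ); ξ]
  have hL : 0 < ‖∫ s : ℝ, (Real.exp (-(v / 2) * s ^ 2) : ℂ)‖ := by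
    rw [norm_pos_iff, integral_complex_ofReal, integral_gaussian]
    exact Complex.ofReal_ne_zero.2 (by positivity)
  set L := ‖∫ s : ℝ, (Real.exp (-(v / 2) * s ^ 2) : ℂ)‖
  obtain ⟨N₀, hN₀⟩ := eventually_atTop.1 (hlim.eventually_const_le (half_lt_self hL))
  obtain ⟨c, hc, H⟩ := exists_pos_forall_le (f := fun N => walkMass ξ N (N - 1) * √N)
    (P := fun N => 1 ≤ N ∧ walkMass ξ N (N - 1) ≠ 0) (c := h / (2 * Real.pi) * (L / 2))
    (fun N hN => by
      have : (0 : ℝ) < N := Nat.cast_pos.2 hN.1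
      have := lt_of_le_of_ne (walkMass_nonneg ξ N (N - 1)) hN.2.symm
      positivity) (by positivity) N₀ fun N hN hP => by
      have h1 := hN₀ N hN
      have h2 := hh.walkMass_eq (N := N) (hh.dvd_of_walkMass_ne_zero hP.2)
      have h3 (t : ℝ) : phi ξ t ^ N * Complex.exp (-(t * (N - 1 : ℕ) * Complex.I)) =
          (phi ξ t * Complex.exp (-((t : ℝ) * Complex.I))) ^ N * Complex.exp (t * Complex.I) := by
        rw [mul_pow, ← Complex.exp_nat_mul, mul_assoc (phi ξ t ^ N), ← Complex.exp_add,
          Nat.cast_sub hP.1]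
        congr 2
        push_cast
        ring
      simp only [h3] at h2
      rw [← h2, norm_mul, norm_mul, Complex.norm_real, Complex.norm_real, Complex.norm_real,
        Real.norm_of_nonneg (by positivity), Real.norm_of_nonneg (by positivity),
        Real.norm_of_nonneg (walkMass_nonneg ξ _ _)] at h1
      have h4 : h / (2 * Real.pi) * (L / 2) ≤
          h / (2 * Real.pi) * (√N * (2 * Real.pi / h * walkMass ξ N (N - 1))) := by gcongr
      refine h4.trans_eq ?_
      field_simp
  refine ⟨c, hc, fun N hN hne => ?_⟩
  have : (0 : ℝ) < N := Nat.cast_pos.2 hN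
  rw [div_le_iff₀ (Real.sqrt_pos.2 this)]
  exact H N ⟨hN, hne⟩

end

theorem exists_revDist_eq (v w : List ℕ) :
    ∃ u a b : List ℕ, v = u ++ a ∧ w = u ++ b ∧ revDist v w = a.length + b.length := by
  induction v generalizing w with
  | nil => exact ⟨[], [], w, by simp [revDist]⟩
  | cons i v ih =>
    cases w with
    | nil => exact ⟨[], i :: v, [], by simp [revDist]⟩
    | cons j w =>
      by_cases hij : i = j
      · obtain ⟨u, a, b, hv, hw, hd⟩ := ih w
        exact ⟨i :: u, a, b, by simp [hv], by simp [hw, hij], by simp [revDist, hij, hd]⟩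
      · exact ⟨[], i :: v, j :: w, by simp, by simp, by simp [revDist, hij]; omega⟩

theorem exists_wordDist_eq (v w : List ℕ) :
    ∃ u a b : List ℕ, v = a ++ u ∧ w = b ++ u ∧ wordDist v w = a.length + b.length := by
  obtain ⟨u, a, b, hv, hw, hd⟩ := exists_revDist_eq v.reverse w.reverse
  refine ⟨u.reverse, a.reverse, b.reverse, ?_, ?_, by simpa [wordDist] using hd⟩
  · rw [← List.reverse_append, ← hv, List.reverse_reverse]
  · rw [← List.reverse_append, ← hw, List.reverse_reverse]

theorem revDist_self (v : List ℕ) : revDist v v = 0 := by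
  induction v with
  | nil => rfl
  | cons i v ih => simpa [revDist] using ih

theorem wordDist_self (v : List ℕ) : wordDist v v = 0 := revDist_self _

theorem revDist_concat (v w : List ℕ) (i : ℕ) :
    revDist v (w ++ [i]) ≤ revDist v w + 1 ∧ revDist v w ≤ revDist v (w ++ [i]) + 1 := by
  induction v generalizing w with
  | nil => simp [revDist]; omega
  | cons a v ih =>
    cases w with
    | nil =>
      by_cases h : a = i
      · cases v <;> simp [revDist, h]
      · simp [revDist, h]
    | cons b w =>
      by_cases h : a = b
      · simpa [revDist, h] using ih w
      · simp [revDist, h]; omega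

theorem wordDist_cons (v w : List ℕ) (i : ℕ) :
    wordDist v (i :: w) ≤ wordDist v w + 1 ∧ wordDist v w ≤ wordDist v (i :: w) + 1 := by
  simpa [wordDist] using revDist_concat v.reverse w.reverse i

namespace FinRootedTree

variable (τ : FinRootedTree)

theorem adj_cons {i : ℕ} {u : List ℕ} (h : i :: u ∈ τ.verts) (hu : u ∈ τ.verts) :
    τ.graph.Adj ⟨i :: u, h⟩ ⟨u, hu⟩ := by
  rw [graph, SimpleGraph.fromRel_adj]
  exact ⟨by simp, Or.inr ⟨i, rfl⟩⟩

theorem wordDist_le_length {v w : {u // u ∈ τ.verts}} (p : τ.graph.Walk v w)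
    (s : List ℕ) : wordDist s w ≤ wordDist s v + p.length := by
  induction p with
  | nil => simp
  | @cons u v _ h p ih =>
    rw [graph, SimpleGraph.fromRel_adj] at h
    rw [SimpleGraph.Walk.length_cons]
    rcases h.2 with ⟨i, hi⟩ | ⟨i, hi⟩
    · have := wordDist_cons s u i
      rw [← hi] at this
      omega
    · have := wordDist_cons s v i
      rw [← hi] at this
      omega

theorem exists_walk_append (a u : List ℕ) (h : a ++ u ∈ τ.verts) :
    ∃ hu : u ∈ τ.verts, ∃ p : τ.graph.Walk ⟨a ++ u, h⟩ ⟨u, hu⟩, p.length = a.length := by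
  induction a with
  | nil => exact ⟨h, SimpleGraph.Walk.nil, rfl⟩
  | cons i a ih =>
    have h' := τ.parent_mem i (a ++ u) h
    obtain ⟨hu, p, hp⟩ := ih h'
    exact ⟨hu, SimpleGraph.Walk.cons (τ.adj_cons h h') p, by simp [hp]⟩

theorem dist_eq_wordDist (v w : {u // u ∈ τ.verts}) : τ.graph.dist v w = wordDist v w := by
  obtain ⟨v, hv⟩ := v
  obtain ⟨w, hw⟩ := w
  obtain ⟨u, a, b, rfl, rfl, hd⟩ := exists_wordDist_eq v w
  obtain ⟨hu, p, hp⟩ := τ.exists_walk_append a u hv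
  obtain ⟨_, q, hq⟩ := τ.exists_walk_append b u hw
  refine le_antisymm ?_ ?_
  · rw [hd]
    refine (SimpleGraph.dist_le (p.append q.reverse)).trans_eq ?_
    rw [SimpleGraph.Walk.length_append, SimpleGraph.Walk.length_reverse, hp, hq]
  · obtain ⟨r, hr⟩ := SimpleGraph.Reachable.exists_walk_length_eq_dist ⟨p.append q.reverse⟩
    have := τ.wordDist_le_length r (a ++ u)
    rwa [wordDist_self, zero_add, hr] at this

theorem natCast_Z_reroot (k : ℕ) (v : {u // u ∈ τ.verts}) :
    (Z k (τ.reroot v) : ℝ≥0∞) =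
      ∑' w, (if wordDist v w = k then 1 else 0) * (τ.verts : Set (List ℕ)).indicator 1 w := by
  classical
  have h : Z k (τ.reroot v) = Nat.card {w : {u // u ∈ τ.verts} // wordDist v w = k} := by
    simp only [← dist_eq_wordDist]
    rfl
  rw [h, Nat.card_eq_fintype_card, Fintype.card_subtype, Finset.card_filter, Nat.cast_sum,
    ← tsum_fintype (L := .unconditional _)]
  push_cast
  rw [Finset.tsum_subtype τ.verts fun w => if wordDist v w = k then (1 : ℝ≥0∞) else 0,
    tsum_eq_sum (s := τ.verts)]
  · exact Finset.sum_congr rfl fun w hw => by simp [hw]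
  · intro w hw
    simp [hw]

theorem sum_Z_reroot {x : List ℕ → ℕ} (h : (τ.verts : Set (List ℕ)) = familyTree x) (k : ℕ) :
    ∑ v : {u // u ∈ τ.verts}, (Z k (τ.reroot v) : ℝ≥0∞) = pairCount k x := by
  simp only [natCast_Z_reroot, h]
  rw [← tsum_fintype (L := .unconditional _), Finset.tsum_subtype τ.verts fun v => ∑' w,
    (if wordDist v w = k then 1 else 0) * (familyTree x).indicator (1 : List ℕ → ℝ≥0∞) w,
    pairCount, tsum_eq_sum (s := τ.verts)]
  · refine Finset.sum_congr rfl fun v hv => ?_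
    have : v ∈ familyTree x := by rw [← h]; exact hv
    simp [bornInd, this]
  · intro v hv
    have : v ∉ familyTree x := by rw [← h]; exact hv
    simp [bornInd, this]

theorem lintegral_Z_uniform (k : ℕ) :
    ∫⁻ σ, (Z k σ : ℝ≥0∞) ∂((PMF.uniformOfFintype {u // u ∈ τ.verts}).map τ.reroot).toMeasure =
      (∑ v : {u // u ∈ τ.verts}, (Z k (τ.reroot v) : ℝ≥0∞)) * (τ.verts.card : ℝ≥0∞)⁻¹ := by
  let : MeasurableSpace {u // u ∈ τ.verts} := ⊤
  have : MeasurableSingletonClass {u // u ∈ τ.verts} := ⟨fun _ => trivial⟩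
  rw [← PMF.toMeasure_map _ _ measurable_from_top,
    lintegral_map measurable_from_top measurable_from_top, lintegral_fintype, Finset.sum_mul]
  refine Finset.sum_congr rfl fun v _ => ?_
  rw [PMF.toMeasure_apply_singleton _ _ (measurableSet_singleton v), PMF.uniformOfFintype_apply,
    Fintype.card_coe]

end FinRootedTree

theorem coe_verts_finiteFamilyTree {x : List ℕ → ℕ} {n : ℕ} (hx : x ∈ sizeEvent n) :
    ((finiteFamilyTree x).verts : Set (List ℕ)) = familyTree x := by
  have h : (familyTree x).Finite := Set.finite_of_encard_eq_coe hx
  simp [finiteFamilyTree, dif_pos h]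

theorem card_verts_finiteFamilyTree {x : List ℕ → ℕ} {n : ℕ} (hx : x ∈ sizeEvent n) :
    (finiteFamilyTree x).verts.card = n := by
  have h : (familyTree x).encard = n := hx
  rw [← coe_verts_finiteFamilyTree hx, Set.encard_coe_eq_coe_finsetCard] at h
  exact_mod_cast h

theorem tsum_coeff_derivative_derivative_offspringSeries_ne_top {ξ : Measure ℕ}
    (hL2 : MemLp (fun i : ℕ => (i : ℝ)) 2 ξ) :
    ∑' d, coeff d (d⁄dX ℝ≥0∞ (d⁄dX ℝ≥0∞ (offspringSeries ξ))) ≠ ⊤ := by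
  have h := hL2.integrable_sq.lintegral_lt_top
  refine ne_top_of_le_ne_top h.ne ?_
  rw [lintegral_countable']
  refine le_trans ?_ (ENNReal.tsum_comp_le_tsum_of_injective (add_left_injective 2) _)
  refine ENNReal.tsum_le_tsum fun d => ?_
  simp only [coeff_derivative, offspringSeries, coeff_mk]
  rw [mul_assoc, mul_comm (ξ {d + 1 + 1})]
  gcongr
  rw [← Nat.cast_pow, ENNReal.ofReal_natCast]
  norm_cast
  nlinarith

theorem tsum_coeff_X_pow (m : ℕ) : ∑' d, coeff d (X ^ m : ℝ≥0∞⟦X⟧) = 1 := by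
  simp [coeff_X_pow]

variable (ξ : Measure ℕ) [IsProbabilityMeasure ξ]

theorem lintegral_Z_rerootedTree (k n : ℕ) :
    ∫⁻ τ, (FinRootedTree.Z k τ : ℝ≥0∞) ∂(rerootedTree ξ n) =
      (offspringArray ξ (sizeEvent n))⁻¹ *
        (coeff n (weightedSeries ξ (pairCount k)) * (n : ℝ≥0∞)⁻¹) := by
  rw [rerootedTree, Measure.lintegral_bind measurable_from_top.aemeasurable
    measurable_from_top.aemeasurable, condTree,
    lintegral_map measurable_from_top measurable_finiteFamilyTree, ProbabilityTheory.cond,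
    lintegral_smul_measure, coeff_weightedSeries,
    ← lintegral_mul_const _ (measurable_pairCount k), smul_eq_mul]
  congr 1
  refine setLIntegral_congr_fun (measurableSet_sizeEvent n) fun x hx => ?_
  rw [FinRootedTree.lintegral_Z_uniform, card_verts_finiteFamilyTree hx,
    FinRootedTree.sum_Z_reroot _ (coe_verts_finiteFamilyTree hx)]

variable {ξ}

theorem pairCount_le {x : List ℕ → ℕ} {n : ℕ} (hx : x ∈ sizeEvent n) (k : ℕ) :
    pairCount k x ≤ n * n := by
  have h : ∑' u, bornInd x u = n := by
    have h1 : ((familyTree x).encard : ℝ≥0∞) = n := by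
      have h2 : (familyTree x).encard = n := hx
      rw [h2, ENat.toENNReal_coe]
    rw [← h1, ← ENNReal.tsum_set_one, tsum_subtype (familyTree x) fun _ => (1 : ℝ≥0∞)]
    simp [bornInd, Pi.one_def]
  rw [← h, ← ENNReal.tsum_mul_left, pairCount]
  refine ENNReal.tsum_le_tsum fun v => ?_
  gcongr with w
  split_ifs <;> simp

theorem coeff_weightedSeries_pairCount_le (k n : ℕ) :
    coeff n (weightedSeries ξ (pairCount k)) ≤ n * (n * coeff n (sizeSeries ξ)) := by
  rw [coeff_weightedSeries, coeff_sizeSeries]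
  refine (setLIntegral_mono' (measurableSet_sizeEvent n) fun x hx => pairCount_le hx k).trans ?_
  rw [setLIntegral_const, mul_assoc]

theorem tsum_coeff_derivative_offspringSeries (hL2 : MemLp (fun i : ℕ => (i : ℝ)) 2 ξ)
    (hmean : ∫ i : ℕ, (i : ℝ) ∂ξ = 1) :
    ∑' d, coeff d (d⁄dX ℝ≥0∞ (offspringSeries ξ)) = 1 := by
  have h := ofReal_integral_eq_lintegral_ofReal (integrable_natCast hL2)
    (.of_forall fun i => Nat.cast_nonneg i)
  rw [hmean, ENNReal.ofReal_one, lintegral_countable', tsum_eq_zero_add' ENNReal.summable] at h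
  rw [h]
  simp only [coeff_derivative, offspringSeries, coeff_mk, ENNReal.ofReal_natCast]
  push_cast
  simp [mul_comm]

theorem coeff_weightedSeries_pairCount_le_of_le (hL2 : MemLp (fun i : ℕ => (i : ℝ)) 2 ξ)
    (hmean : ∫ i : ℕ, (i : ℝ) ∂ξ = 1) {c : ℝ} (hc : 0 ≤ c)
    (H : ∀ N j : ℕ, 1 ≤ N → walkMass ξ N j ≤ c / √N) {k n : ℕ} (hk : 1 ≤ k) (hkn : 2 * k ≤ n) :
    coeff n (weightedSeries ξ (pairCount k)) ≤
      (2 + ∑' d, coeff d (d⁄dX ℝ≥0∞ (d⁄dX ℝ≥0∞ (offspringSeries ξ)))) * k *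
        ENNReal.ofReal (c * √2 / √n) := by
  have hn : (0 : ℝ) < n := Nat.cast_pos.2 (by omega)
  have key (N : ℕ) (hN : n ≤ 2 * N) (j : ℕ) :
      coeff j (offspringSeries ξ ^ N) ≤ ENNReal.ofReal (c * √2 / √n) := by
    have hN0 : (0 : ℝ) < N := Nat.cast_pos.2 (by omega)
    rw [← ofReal_walkMass]
    refine ENNReal.ofReal_le_ofReal ((H N j (by omega)).trans ?_)
    rw [div_le_div_iff₀ (Real.sqrt_pos.2 hN0) (Real.sqrt_pos.2 hn), mul_assoc,
      ← Real.sqrt_mul zero_le_two]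
    gcongr
    exact_mod_cast hN
  rw [coeff_weightedSeries_pairCount hk (by omega)]
  have h1 := coeff_mul_le (d⁄dX ℝ≥0∞ (offspringSeries ξ) ^ k * X) _ _
    (key (n - k) (by omega)) (n - k)
  have h2 := coeff_mul_le (d⁄dX ℝ≥0∞ (d⁄dX ℝ≥0∞ (offspringSeries ξ)) *
    d⁄dX ℝ≥0∞ (offspringSeries ξ) ^ (k - 2) * X ^ 2) _ _
    (key (n - (k - 1)) (by omega)) (n - (k - 1))
  have hX := tsum_coeff_X_pow 1
  rw [pow_one] at hX
  rw [tsum_coeff_mul, tsum_coeff_pow, tsum_coeff_derivative_offspringSeries hL2 hmean, one_pow,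
    hX, one_mul] at h1
  rw [tsum_coeff_mul, tsum_coeff_mul, tsum_coeff_pow,
    tsum_coeff_derivative_offspringSeries hL2 hmean, one_pow, tsum_coeff_X_pow, mul_one,
    mul_one] at h2
  set S := ∑' d, coeff d (d⁄dX ℝ≥0∞ (d⁄dX ℝ≥0∞ (offspringSeries ξ)))
  set u := ENNReal.ofReal (c * √2 / √n)
  have hk' : (1 : ℝ≥0∞) ≤ k := by exact_mod_cast hk
  calc _ ≤ 2 * (1 * u) + k * (S * u) := by
        gcongr
        exact card_splits_le k
    _ ≤ 2 * (k * u) + k * (S * u) := by gcongr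
    _ = (2 + S) * k * u := by ring

end GaltonWatson

theorem corollary1p2 (ξ : Measure ℕ) [IsProbabilityMeasure ξ]
    (hL2 : MemLp (fun i : ℕ => (i : ℝ)) 2 ξ)
    (hmean : ∫ i : ℕ, (i : ℝ) ∂ξ = 1)
    (hvar : 0 < Var[fun i : ℕ => (i : ℝ); ξ]) :
    ∃ C : ℝ≥0, ∀ k n : ℕ, 1 ≤ k → 1 ≤ n →
      0 < GaltonWatson.offspringArray ξ (GaltonWatson.sizeEvent n) →
        ∫⁻ τ, (GaltonWatson.FinRootedTree.Z k τ : ℝ≥0∞) ∂(GaltonWatson.rerootedTree ξ n)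
          ≤ (C : ℝ≥0∞) * (k : ℝ≥0∞) := by
  open GaltonWatson PowerSeries in
  obtain ⟨b, hb, hbp⟩ := exists_real_ne_zero hmean
  obtain ⟨h, hh⟩ := exists_isSpan hb hbp
  obtain ⟨c₁, hc₁, H₁⟩ := hh.exists_walkMass_le hb hbp (real_zero_ne_zero hL2 hmean hvar)
  obtain ⟨c₂, hc₂, H₂⟩ := exists_le_walkMass hL2 hmean hvar
  set S := ∑' d, coeff d (d⁄dX ℝ≥0∞ (d⁄dX ℝ≥0∞ (offspringSeries ξ)))
  have hS : S ≠ ⊤ := tsum_coeff_derivative_derivative_offspringSeries_ne_top hL2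
  set B : ℝ≥0∞ := 2 + (2 + S) * ENNReal.ofReal (c₁ * √2 / c₂) with hB
  have hBtop : B ≠ ⊤ := by finiteness
  refine ⟨B.toNNReal, fun k n hk hn hq => ?_⟩
  rw [ENNReal.coe_toNNReal hBtop, lintegral_Z_rerootedTree]
  have hn0 : (n : ℝ≥0∞) ≠ 0 := by exact_mod_cast (by omega : n ≠ 0)
  set q := offspringArray ξ (sizeEvent n) with hqdef
  have hqtop : q ≠ ⊤ := measure_ne_top _ _
  have hnq : (n : ℝ≥0∞) * q = ENNReal.ofReal (walkMass ξ n (n - 1)) := by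
    rw [hqdef, ← coeff_sizeSeries, mul_coeff_eq (sizeSeries_eq ξ), ofReal_walkMass]
    obtain ⟨m, rfl⟩ := Nat.exists_eq_add_of_le' hn
    rw [coeff_succ_X_mul, Nat.add_sub_cancel]
  have hinv (a : ℝ≥0∞) : q⁻¹ * (a * (n : ℝ≥0∞)⁻¹) = a / (n * q) := by
    rw [div_eq_mul_inv, ENNReal.mul_inv (Or.inl hn0) (Or.inr hq.ne')]
    ring
  rw [hinv]
  refine ENNReal.div_le_of_le_mul ?_
  by_cases hkn : 2 * k ≤ n
  · refine (coeff_weightedSeries_pairCount_le_of_le hL2 hmean hc₁ H₁ hk hkn).trans ?_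
    have hw : walkMass ξ n (n - 1) ≠ 0 := by
      intro h0
      rw [h0, ENNReal.ofReal_zero] at hnq
      exact (mul_ne_zero hn0 hq.ne') hnq
    have hle : ENNReal.ofReal (c₂ / √n) ≤ n * q := by
      rw [hnq]
      exact ENNReal.ofReal_le_ofReal (H₂ n hn hw)
    have heq : ENNReal.ofReal (c₁ * √2 / √n) =
        ENNReal.ofReal (c₁ * √2 / c₂) * ENNReal.ofReal (c₂ / √n) := by
      rw [← ENNReal.ofReal_mul (by positivity)]
      congr 1
      field_simp
    calc _ = (2 + S) * ENNReal.ofReal (c₁ * √2 / c₂) * k * ENNReal.ofReal (c₂ / √n) := by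
          rw [heq]
          ring
      _ ≤ B * k * (n * q) := by
          gcongr
          exact le_add_self
  · refine (coeff_weightedSeries_pairCount_le k n).trans ?_
    rw [coeff_sizeSeries]
    gcongr
    calc (n : ℝ≥0∞) ≤ 2 * k := by exact_mod_cast (by omega : n ≤ 2 * k)
      _ ≤ B * k := by
          gcongr
          exact le_self_add
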